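/- Setting. Alice prepares $n$ EPR pairs $(|00\rangle+|11\rangle)/\sqrt2$ and sends half of each to Bob through a channel that acts as an arbitrary superoperator on at most $t$ of the $n$ transmitted qubits and as the identity on the others. In an adaptive stabilizer 2-EPP, Alice and Bob measure Pauli operators one after the other, each operator being measured by both of them on their own halves; after each measurement they exchange the outcomes. The next operator may depend on all earlier outcomes but commutes with all operators measured before. At the end they apply local unitaries $U_A$, $U_B$, keep some of the pairs and discard the others, all depending on the outcomes. The protocol produces at least $k$ perfect EPR pairs in the presence of $t$ errors if, for every such channel and all measurement outcomes that occur, at least $k$ pairs are kept and the kept pairs are exactly in the state $\bigl((|00\rangle+|11\rangle)/\sqrt2\bigr)^{\otimes}$ (fidelity $1$). Theorem. Let $m\ge 2$. There is an adaptive stabilizer 2-EPP that produces at least $2^m-m-2$ perfect EPR pairs from $2^m-1$ pairs in the presence of one error. More precisely, number the pairs $0,1,\dots,2^m-2$ and write the numbers in binary with $m$ digits. For a suitable choice, depending on the outcomes, of the final local unitaries and of the kept pairs, this is achieved by the following measurements, which commute on every branch: (a) First $X^{\otimes(2^m-1)}$ is measured. (b) If the outcomes of Alice and Bob differ (a $Y$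 or $Z$ error), a binary search with $m-1$ steps follows. The initial candidate set $S_1$ consists of all pairs. In step $i$ the product of $X$ is measured over the set $S_i'$ of those pairs in $S_i$ whose $i$-th digit (from the left) is $0$; $S_{i+1}=S_i'$ if the outcomes differ and $S_{i+1}=S_i\setminus S_i'$ otherwise. (c) If the outcomes in (a) agree (no error or an $X$ error), the $m$ parity checks of the Hamming code follow: for $j=1,\dots,m$ the product of $Z$ is measured over all pairs whose $j$-th digit is $0$. Comparison. For every $m\ge2$ there is a stabilizer quantum error-correcting code that encodes the same number $k=2^m-m-2$ of qubits and corrects one error, but uses $2^m$ qubits, one more than the $2^m-1$ pairs above. (Here a code with stabilizer $S$ of order $2^{n-k}$ on $n$ qubits corrects one error if every Pauli operator on at most two qubits that commutes with $S$ is, up to a phase, in $S$.) Moreover, the parameters $n=2^m-1$, $k=2^m-m-2$, $t=1$ of the 2-EPP violate the quantum Hamming bound $2^k\sum_{j=0}^{t}3^j\binom nj\le 2^n$. -/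

import Mathlib

open scoped Kronecker

noncomputable section

/-! ### Qubits, Pauli operators, EPR pairs -/

/-- Labels of the computational basis of a register of qubits indexed by `ι`. -/
abbrev QBasis (ι : Type) : Type := ι → Fin 2

/-- Operators on a register of qubits indexed by `ι`. -/
abbrev QOp (ι : Type) : Type := Matrix (QBasis ι) (QBasis ι) ℂ

/-- Operators on Alice's register (first factor) together with Bob's (second factor), the register
of each of them being indexed by `ι`; the `i`-th pair consists of Alice's and Bob's `i`-th qubits. -/
abbrev PairOp (ι : Type) : Type :=
  Matrix (QBasis ι × QBasis ι) (QBasis ι × QBasis ι) ℂ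

inductive Pauli : Type
  | I
  | X
  | Y
  | Z
  deriving DecidableEq

def Pauli.toMatrix : Pauli → Matrix (Fin 2) (Fin 2) ℂ
  | .I => !![1, 0; 0, 1]
  | .X => !![0, 1; 1, 0]
  | .Y => !![0, -Complex.I; Complex.I, 0]
  | .Z => !![1, 0; 0, -1]

/-- A tensor product of `n` Pauli matrices, with overall phase `1`. -/
abbrev PauliString (n : ℕ) : Type := Fin n → Pauli

namespace PauliString

/-- The tensor product of the matrices of the letters. -/
def toMatrix {n : ℕ} (P : PauliString n) : QOp (Fin n) :=
  Matrix.of fun x y => ∏ i, (P i).toMatrix (x i) (y i)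

/-- The number of qubits on which the string acts nontrivially. -/
def weight {n : ℕ} (P : PauliString n) : ℕ :=
  (Finset.univ.filter fun i => P i ≠ Pauli.I).card

/-- The product of the operators `X` over the qubits in `S`. -/
def xOn {n : ℕ} (S : Finset (Fin n)) : PauliString n :=
  fun i => if i ∈ S then Pauli.X else Pauli.I

/-- The product of the operators `Z` over the qubits in `S`. -/
def zOn {n : ℕ} (S : Finset (Fin n)) : PauliString n :=
  fun i => if i ∈ S then Pauli.Z else Pauli.I

/-- The projector onto the eigenspace of `P` with eigenvalue `1` (outcome `false`) or `-1`
(outcome `true`). -/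
def proj {n : ℕ} (P : PauliString n) (outcome : Bool) : QOp (Fin n) :=
  (1 / 2 : ℂ) • (1 + (if outcome then (-1 : ℂ) else 1) • P.toMatrix)

end PauliString

/-- The state vector `⨂ᵢ (|00⟩ + |11⟩) / √2` of perfect EPR pairs indexed by `ι`. -/
def eprVector (ι : Type) [Fintype ι] : QBasis ι × QBasis ι → ℂ :=
  fun p => ∏ i, if p.1 i = p.2 i then ((1 / Real.sqrt 2 : ℝ) : ℂ) else 0

/-- The density operator of perfect EPR pairs indexed by `ι`. -/
def eprState (ι : Type) [Fintype ι] : PairOp ι :=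
  Matrix.vecMulVec (eprVector ι) (star (eprVector ι))

/-- The basis label that is `x` on `K` and `u` off `K`. -/
def glue {n : ℕ} (K : Finset (Fin n)) (x : QBasis {i // i ∈ K}) (u : QBasis {i // i ∉ K}) :
    QBasis (Fin n) :=
  fun i => if h : i ∈ K then x ⟨i, h⟩ else u ⟨i, h⟩

/-- The state of the pairs in `K`: the partial trace over both halves of all other pairs. -/
def keepPairs {n : ℕ} (K : Finset (Fin n)) (ρ : PairOp (Fin n)) : PairOp {i // i ∈ K} :=
  Matrix.of fun p q => ∑ u : QBasis {i // i ∉ K}, ∑ v : QBasis {i // i ∉ K},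
    ρ (glue K p.1 u, glue K p.2 v) (glue K q.1 u, glue K q.2 v)

/-! ### Errors -/

/-- `E` is of the form `M ⊗ 1` with `M` acting on the qubits in `T` and `1` on the others. -/
def ActsOn {n : ℕ} (T : Finset (Fin n)) (E : QOp (Fin n)) : Prop :=
  ∃ M : QOp {i // i ∈ T}, ∀ x y : QBasis (Fin n),
    E x y = if ∀ i, i ∉ T → x i = y i then M (fun i => x i.1) (fun i => y i.1) else 0

/-- The state of `n` EPR pairs after Bob's halves went through the superoperator with Kraus
operators `E 0, …, E (r - 1)`. -/
def noisyPairs {n r : ℕ} (E : Fin r → QOp (Fin n)) : PairOp (Fin n) :=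
  ∑ j, ((1 : QOp (Fin n)) ⊗ₖ E j) * eprState (Fin n) * ((1 : QOp (Fin n)) ⊗ₖ E j).conjTranspose

/-! ### Two-way entanglement purification by adaptive Pauli measurements -/

/-- The last stage of a protocol: unitaries `UA` of Alice and `UB` of Bob, after which the pairs in
`kept` are the output and all other qubits are discarded. -/
structure FinalStep (n : ℕ) where
  UA : Matrix.unitaryGroup (QBasis (Fin n)) ℂ
  UB : Matrix.unitaryGroup (QBasis (Fin n)) ℂ
  kept : Finset (Fin n)

/-- A two-way protocol on `n` pairs. In `measure P next` Alice and Bob each measure `P` on their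
own halves and tell each other the outcomes `a` (hers) and `b` (his), where `true` stands for the
eigenvalue `-1`; they continue with `next a b`. -/
inductive EPP (n : ℕ) : Type
  | finish (s : FinalStep n) : EPP n
  | measure (P : PauliString n) (next : Bool → Bool → EPP n) : EPP n

namespace EPP

/-- Every measured operator commutes with the operators `past` and with those measured before it on
the same branch. -/
def CommutesAfter {n : ℕ} : EPP n → List (PauliString n) → Prop
  | finish _, _ => True
  | measure P next, past =>
      (∀ Q ∈ past, Commute P.toMatrix Q.toMatrix) ∧
        ∀ a b, (next a b).CommutesAfter (P :: past)

/-- An adaptive stabilizer protocol: on every branch the measured Pauli operators commute. -/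
def IsStabilizerEPP {n : ℕ} (p : EPP n) : Prop := p.CommutesAfter []

/-- Started in the (unnormalized) state `ρ`, the protocol yields, for all outcomes of the
measurements, at least `k` perfect EPR pairs. An unnormalized state is the normalized one times
the probability of the outcomes that led to it, so that `ρ.trace` is that probability. -/
def Yields {n : ℕ} (k : ℕ) : EPP n → PairOp (Fin n) → Prop
  | finish s, ρ =>
      k ≤ s.kept.card ∧
        keepPairs s.kept
            (((s.UA : QOp (Fin n)) ⊗ₖ (s.UB : QOp (Fin n))) * ρ *
              ((s.UA : QOp (Fin n)) ⊗ₖ (s.UB : QOp (Fin n))).conjTranspose) =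
          ρ.trace • eprState {i // i ∈ s.kept}
  | measure P next, ρ =>
      ∀ a b, (next a b).Yields k ((P.proj a ⊗ₖ P.proj b) * ρ * (P.proj a ⊗ₖ P.proj b))

/-- The protocol produces at least `k` perfect EPR pairs from `n` pairs whenever at most `t` of the
transmitted halves are affected, in whatever way, by the channel. -/
def Corrects {n : ℕ} (p : EPP n) (t k : ℕ) : Prop :=
  ∀ T : Finset (Fin n), T.card ≤ t →
    ∀ (r : ℕ) (E : Fin r → QOp (Fin n)), (∀ j, ActsOn T (E j)) →
      ∑ j, (E j).conjTranspose * E j = 1 → p.Yields k (noisyPairs E)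

/-! ### The measurements of the one-error protocol -/

/-- Binary search for an error that anticommutes with the product of `X` over `S`. The candidates
in `S` agree in all binary digits but the last `s + 1`; in each of the `s` steps the product of `X`
is measured over those candidates whose first undetermined digit is `0`, and the half in which
the outcomes reveal the error is retained. The list is the record of all outcomes so far. -/
def binarySearch {n : ℕ} (final : List (Bool × Bool) → FinalStep n) :
    ℕ → Finset (Fin n) → List (Bool × Bool) → EPP n
  | 0, _, h => finish (final h)
  | s + 1, S, h =>
      measure (PauliString.xOn (S.filter fun i => i.val.testBit (s + 1) = false)) fun a b =>
        binarySearch final s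
          (if a ≠ b then S.filter fun i => i.val.testBit (s + 1) = false
            else S.filter fun i => i.val.testBit (s + 1) = true)
          (h ++ [(a, b)])

/-- The parity checks of the Hamming code, for the last `s` binary digits of the numbers of the
pairs: for each digit, from left to right, the product of `Z` is measured over all pairs whose
number has the digit `0` there. -/
def hammingChecks {n : ℕ} (final : List (Bool × Bool) → FinalStep n) :
    ℕ → List (Bool × Bool) → EPP n
  | 0, h => finish (final h)
  | s + 1, h =>
      measure (PauliString.zOn (Finset.univ.filter fun i => i.val.testBit s = false)) fun a b =>
        hammingChecks final s (h ++ [(a, b)])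

/-- The protocol on `2 ^ m - 1` pairs, numbered `0, …, 2 ^ m - 2`: the product of `X` over all pairs
is measured first; if the outcomes differ, a binary search with `m - 1` steps follows, and if they
agree, the `m` parity checks of the Hamming code. The unitaries applied at the end and
the choice of the retained pairs are given by `final` as a function of the outcomes. -/
def oneErrorProtocol (m : ℕ) (final : List (Bool × Bool) → FinalStep (2 ^ m - 1)) :
    EPP (2 ^ m - 1) :=
  measure (PauliString.xOn Finset.univ) fun a b =>
    if a ≠ b then binarySearch final (m - 1) Finset.univ [(a, b)]
    else hammingChecks final m [(a, b)]

end EPP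

/-! ### Stabilizer codes and the quantum Hamming bound -/

/-- An Abelian group of Pauli operators (with phases `±1`, `±i`) that does not contain `-1`, and
hence not `±i` either. -/
structure IsStabilizer {n : ℕ} (S : Subgroup (QOp (Fin n))ˣ) : Prop where
  pauli : ∀ M ∈ S, ∃ (e : ℕ) (P : PauliString n),
    (M : QOp (Fin n)) = Complex.I ^ e • P.toMatrix
  comm : ∀ M ∈ S, ∀ N ∈ S, M * N = N * M
  neg_one_not_mem : -1 ∉ S

/-- There is a stabilizer code on `n` qubits that encodes `k` qubits (its stabilizer has `n - k`
independent generators, that is, `2 ^ (n - k)` elements) and corrects `t` errors: up to a phase,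
every Pauli operator on fewer than `2 * t + 1` qubits that commutes with the stabilizer is in it. -/
def ExistsStabilizerCode (n k t : ℕ) : Prop :=
  ∃ S : Subgroup (QOp (Fin n))ˣ, IsStabilizer S ∧ Nat.card S * 2 ^ k = 2 ^ n ∧
    ∀ E : PauliString n, E.weight < 2 * t + 1 →
      (∀ M ∈ S, Commute E.toMatrix (M : QOp (Fin n))) →
        ∃ M ∈ S, ∃ e : ℕ, (M : QOp (Fin n)) = Complex.I ^ e • E.toMatrix

/-- The quantum Hamming bound for `k` qubits protected by `n` qubits against `t` errors. -/
def QuantumHammingBound (n k t : ℕ) : Prop :=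
  2 ^ k * ∑ j ∈ Finset.range (t + 1), 3 ^ j * n.choose j ≤ 2 ^ n

end

noncomputable section

/-! ### Shift and phase operators -/

/-! Vectorization replaces the two-party state by a single operator. Noise `E` on Bob's halves turns
the EPR vector into a multiple of the vector of `E`, and `A ⊗ B` sends the vector of `M` to that of
`B M Aᵀ` (`kronecker_mul_mixture`). Kept pairs are perfect once the final operator is the identity
on them tensored with anything (`keepPairs_mixture`). This condition is linear in the error, so
one-qubit noise reduces to the errors 1, X, Z, XZ (`EPP.corrects_one`).

For a Pauli error, measuring `P` on both sides reveals only whether `P` anticommutes with the error,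
and multiplies the operator by a projector of `P` (`PauliString.proj_mul_mul_proj`). It remains to
find a linear reversible map `φ`, applied by both parties, after which the measured operators and
the residual error act on discarded pairs only. Operators with this property form an algebra,
`decoupled φ K`, so each factor can be checked separately.

For a Z or Y error the search finds the position up to its last digit. This suffices, since both
remaining candidates are discarded and nothing need be corrected. All measured sets are unions of
the `m - 1` rejected halves and the final candidate set, so one representative per half absorbs the
X-products: at most `m + 1` pairs are lost. For an X error the checks spell its position in binary,
and the all-ones word, which numbers no pair, means no error. After Bob's flip the discarded pairs
are pair 0, which absorbs the product of all X, and the `m` numbers with a single digit 0, each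
lying in exactly one check.

For the code with `m ≥ 3`, positions are the elements of the field with `2 ^ m` elements. The
stabilizer is generated by the product of all X, the product of all Z, and the operators with
X-exponent `f x` and Z-exponent `f (ω x)`, for `f` linear and a fixed `ω ≠ 0, 1`. An undetected
nontrivial error at positions with difference `d ≠ 0` would make `d`, `ω d` or `(ω - 1) d` vanish.
-/

/-- The sign `(-1) ^ a`. -/
def sgn (a : Fin 2) : ℂ := if a = 0 then 1 else -1

@[simp] theorem sgn_zero : sgn 0 = 1 := rfl

@[simp] theorem sgn_one : sgn 1 = -1 := by simp [sgn]

theorem sgn_add (a b : Fin 2) : sgn (a + b) = sgn a * sgn b := by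
  fin_cases a <;> fin_cases b <;> simp

theorem sgn_mul_self (a : Fin 2) : sgn a * sgn a = 1 := by
  fin_cases a <;> simp

theorem sgn_injective : Function.Injective sgn := by
  intro a b h
  have h1 : (1 : ℂ) ≠ -1 := by norm_num
  have h2 : (-1 : ℂ) ≠ 1 := by norm_num
  fin_cases a <;> fin_cases b <;> simp_all

theorem Fin.two_add_self (a : Fin 2) : a + a = 0 := by
  revert a; decide

theorem Fin.two_cases (a : Fin 2) : a = 0 ∨ a = 1 := by
  revert a; decide

theorem QBasis.add_self {ι : Type} (x : QBasis ι) : x + x = 0 :=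
  funext fun i => Fin.two_add_self (x i)

theorem QBasis.eq_add_iff {ι : Type} {x y v : QBasis ι} : x = y + v ↔ y = x + v := by
  constructor <;> rintro rfl <;> rw [add_assoc, QBasis.add_self, add_zero]

section Operators

variable {n : ℕ}

/-- The character `x ↦ (-1) ^ (w · x)`. -/
def chi (w x : QBasis (Fin n)) : ℂ := ∏ i, sgn (w i * x i)

theorem chi_add (w x y : QBasis (Fin n)) : chi w (x + y) = chi w x * chi w y := by
  simp [chi, mul_add, sgn_add, Finset.prod_mul_distrib]

theorem chi_comm (w x : QBasis (Fin n)) : chi w x = chi x w := by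
  simp [chi, mul_comm]

@[simp] theorem chi_zero (w : QBasis (Fin n)) : chi w 0 = 1 := by
  simp [chi]

@[simp] theorem zero_chi (w : QBasis (Fin n)) : chi 0 w = 1 := by
  simp [chi]

theorem chi_mul_self (w x : QBasis (Fin n)) : chi w x * chi w x = 1 := by
  rw [← chi_add, QBasis.add_self, chi_zero]

theorem chi_single (w : QBasis (Fin n)) (t : Fin n) (a : Fin 2) :
    chi w (Pi.single t a) = sgn (w t * a) := by
  rw [chi, Finset.prod_eq_single t]
  · simp
  · intro i _ hi; simp [hi]
  · simp

/-- The tensor product of the operators `X` over the qubits in the support of `v`. -/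
def xOp (v : QBasis (Fin n)) : QOp (Fin n) := Matrix.of fun x y => if x = y + v then 1 else 0

/-- The tensor product of the operators `Z` over the qubits in the support of `w`. -/
def zOp (w : QBasis (Fin n)) : QOp (Fin n) := Matrix.diagonal (chi w)

theorem xOp_apply (v x y : QBasis (Fin n)) : xOp v x y = if x = y + v then 1 else 0 := rfl

theorem xOp_mul_apply (v : QBasis (Fin n)) (M : QOp (Fin n)) (x y : QBasis (Fin n)) :
    (xOp v * M) x y = M (x + v) y := by
  simp only [Matrix.mul_apply, xOp_apply, QBasis.eq_add_iff (x := x)]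
  simp

theorem mul_xOp_apply (v : QBasis (Fin n)) (M : QOp (Fin n)) (x y : QBasis (Fin n)) :
    (M * xOp v) x y = M x (y + v) := by
  simp [Matrix.mul_apply, xOp_apply]

@[simp] theorem xOp_zero : xOp (0 : QBasis (Fin n)) = 1 := by
  ext x y; simp [xOp_apply, Matrix.one_apply]

theorem xOp_add (v w : QBasis (Fin n)) : xOp (v + w) = xOp v * xOp w := by
  ext x y
  have h : x = y + (v + w) ↔ x + v = y + w := by
    rw [add_left_comm, add_comm v, QBasis.eq_add_iff, eq_comm]
  simp only [xOp_mul_apply, xOp_apply, h]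

theorem xOp_mul_self (v : QBasis (Fin n)) : xOp v * xOp v = 1 := by
  rw [← xOp_add, QBasis.add_self, xOp_zero]

theorem xOp_commute (v w : QBasis (Fin n)) : Commute (xOp v) (xOp w) := by
  rw [Commute, SemiconjBy, ← xOp_add, ← xOp_add, add_comm]

theorem xOp_transpose (v : QBasis (Fin n)) : (xOp v).transpose = xOp v := by
  ext x y
  simp only [Matrix.transpose_apply, xOp_apply, QBasis.eq_add_iff (x := x)]

theorem diagonal_mul_xOp {f : QBasis (Fin n) → ℂ} {v : QBasis (Fin n)} {ε : ℂ}
    (h : ∀ x, f (x + v) = ε * f x) :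
    Matrix.diagonal f * xOp v = ε • (xOp v * Matrix.diagonal f) := by
  ext x y
  rw [Matrix.diagonal_mul, Matrix.smul_apply, Matrix.mul_diagonal, xOp_apply]
  split_ifs with hx
  · subst hx; simp [h]
  · simp

theorem zOp_mul_xOp (w v : QBasis (Fin n)) : zOp w * xOp v = chi w v • (xOp v * zOp w) :=
  diagonal_mul_xOp fun x => by rw [chi_add, mul_comm]

theorem xOp_mul_zOp (w v : QBasis (Fin n)) : xOp v * zOp w = chi w v • (zOp w * xOp v) := by
  rw [zOp_mul_xOp, smul_smul, chi_mul_self, one_smul]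

@[simp] theorem zOp_zero : zOp (0 : QBasis (Fin n)) = 1 := by
  rw [zOp, ← Matrix.diagonal_one]; congr 1; ext x; simp

theorem zOp_add (v w : QBasis (Fin n)) : zOp (v + w) = zOp v * zOp w := by
  rw [zOp, zOp, zOp, Matrix.diagonal_mul_diagonal]
  congr 1; ext x
  rw [chi_comm, chi_add, chi_comm x v, chi_comm x w]

theorem zOp_mul_self (v : QBasis (Fin n)) : zOp v * zOp v = 1 := by
  rw [← zOp_add, QBasis.add_self, zOp_zero]

theorem diagonal_commute (f g : QBasis (Fin n) → ℂ) :
    Commute (Matrix.diagonal f) (Matrix.diagonal g) := by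
  rw [Commute, SemiconjBy, Matrix.diagonal_mul_diagonal, Matrix.diagonal_mul_diagonal]
  simp only [mul_comm]

theorem zOp_commute (v w : QBasis (Fin n)) : Commute (zOp v) (zOp w) := diagonal_commute _ _

theorem zOp_transpose (v : QBasis (Fin n)) : (zOp v).transpose = zOp v :=
  Matrix.diagonal_transpose _

end Operators

/-! ### Pauli strings -/

/-- The label whose entry is `1` on `S` and `0` elsewhere. -/
def ind {n : ℕ} (S : Finset (Fin n)) : QBasis (Fin n) := fun i => if i ∈ S then 1 else 0

namespace Pauli

/-- The exponent of `X` in a Pauli matrix. -/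
def xPart : Pauli → Fin 2
  | I => 0
  | X => 1
  | Y => 1
  | Z => 0

/-- The exponent of `Z` in a Pauli matrix. -/
def zPart : Pauli → Fin 2
  | I => 0
  | X => 0
  | Y => 1
  | Z => 1

/-- The exponent of `i` in a Pauli matrix. -/
def phase : Pauli → ℕ
  | Y => 1
  | _ => 0

theorem toMatrix_apply (P : Pauli) (a b : Fin 2) :
    P.toMatrix a b =
      Complex.I ^ P.phase * ((if a = b + P.xPart then 1 else 0) * sgn (P.zPart * b)) := by
  cases P <;> fin_cases a <;> fin_cases b <;> simp [toMatrix, xPart, zPart, phase]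

end Pauli

namespace PauliString

variable {n : ℕ}

theorem toMatrix_eq (P : PauliString n) :
    P.toMatrix = Complex.I ^ (∑ i, (P i).phase) •
      (xOp (fun i => (P i).xPart) * zOp (fun i => (P i).zPart)) := by
  ext x y
  simp only [toMatrix, Matrix.of_apply, Pauli.toMatrix_apply, Finset.prod_mul_distrib,
    Finset.prod_pow_eq_pow_sum, Matrix.smul_apply, smul_eq_mul, zOp, Matrix.mul_diagonal,
    xOp_apply, chi]
  congr 2
  simp [Finset.prod_ite_zero, funext_iff]

theorem toMatrix_xOn (S : Finset (Fin n)) : (xOn S).toMatrix = xOp (ind S) := by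
  rw [toMatrix_eq]
  have h1 : (fun i => (xOn S i).xPart) = ind S := by
    ext i; simp only [xOn, ind]; split_ifs <;> rfl
  have h2 : (fun i => (xOn S i).zPart) = 0 := by
    ext i; simp only [xOn]; split_ifs <;> rfl
  have h3 : ∑ i, (xOn S i).phase = 0 :=
    Finset.sum_eq_zero fun i _ => by simp only [xOn]; split_ifs <;> rfl
  rw [h1, h2, h3]; simp

theorem toMatrix_zOn (S : Finset (Fin n)) : (zOn S).toMatrix = zOp (ind S) := by
  rw [toMatrix_eq]
  have h1 : (fun i => (zOn S i).xPart) = 0 := by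
    ext i; simp only [zOn]; split_ifs <;> rfl
  have h2 : (fun i => (zOn S i).zPart) = ind S := by
    ext i; simp only [zOn, ind]; split_ifs <;> rfl
  have h3 : ∑ i, (zOn S i).phase = 0 :=
    Finset.sum_eq_zero fun i _ => by simp only [zOn]; split_ifs <;> rfl
  rw [h1, h2, h3]; simp

theorem toMatrix_conjTranspose (P : PauliString n) : P.toMatrix.conjTranspose = P.toMatrix := by
  ext x y
  simp only [Matrix.conjTranspose_apply, toMatrix, Matrix.of_apply, star_prod]
  refine Finset.prod_congr rfl fun i _ => ?_
  generalize P i = Q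
  generalize x i = a
  generalize y i = b
  cases Q <;> fin_cases a <;> fin_cases b <;> simp [Pauli.toMatrix]

theorem proj_conjTranspose (P : PauliString n) (a : Bool) :
    (P.proj a).conjTranspose = P.proj a := by
  cases a <;> simp [proj, Matrix.conjTranspose_add, toMatrix_conjTranspose]

theorem proj_transpose {P : PauliString n} (hP : P.toMatrix.transpose = P.toMatrix) (a : Bool) :
    (P.proj a).transpose = P.proj a := by
  cases a <;> simp [proj, hP]

theorem proj_mul_proj {P : PauliString n} (hP : P.toMatrix * P.toMatrix = 1) (a b : Bool) :
    P.proj b * P.proj a = if a = b then P.proj a else 0 := by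
  cases a <;> cases b <;>
    simp only [proj, smul_mul_assoc, mul_smul_comm, mul_add, add_mul, hP,
      mul_one, one_mul, if_true, if_false, reduceCtorEq] <;> module

/-- Projecting on both sides an operator that commutes or anticommutes with the measured one. -/
theorem proj_mul_mul_proj {P : PauliString n} (hP : P.toMatrix * P.toMatrix = 1) {c : Fin 2}
    {M : QOp (Fin n)} (h : P.toMatrix * M = sgn c • (M * P.toMatrix)) (a b : Bool) :
    P.proj b * M * P.proj a = if (a ≠ b ↔ c = 1) then M * P.proj a else 0 := by
  -- Moving the projector past `M` switches its eigenvalue exactly when `P` anticommutes with `M`.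
  have key : P.proj b * M = M * P.proj (if c = 1 then !b else b) := by
    fin_cases c <;> cases b <;> simp_all [proj, mul_add, add_mul]
  rw [key, mul_assoc, proj_mul_proj hP]
  fin_cases c <;> cases a <;> cases b <;> simp

end PauliString

/-! ### Mixtures of vectorized operators -/

/-- The unnormalized mixture of the vectors `∑ M y x |x⟩|y⟩`. -/
def mixture {n r : ℕ} (M : Fin r → QOp (Fin n)) : PairOp (Fin n) :=
  ∑ j, Matrix.vecMulVec (M j).vec (star (M j).vec)

theorem kronecker_mul_mixture {n r : ℕ} (A B : QOp (Fin n)) (M : Fin r → QOp (Fin n)) :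
    (A ⊗ₖ B) * mixture M * (A ⊗ₖ B).conjTranspose =
      mixture fun j => B * M j * A.transpose := by
  simp only [mixture, Finset.mul_sum, Finset.sum_mul]
  refine Finset.sum_congr rfl fun j _ => ?_
  rw [Matrix.mul_vecMulVec, Matrix.vecMulVec_mul, ← Matrix.star_mulVec,
    Matrix.kronecker_mulVec_vec]

/-- The amplitude of every nonzero entry of the state vector of perfect EPR pairs. -/
def eprAmplitude (ι : Type) [Fintype ι] : ℂ := ((1 / Real.sqrt 2 : ℝ) : ℂ) ^ Fintype.card ι

theorem eprVector_apply {ι : Type} [Fintype ι] (p : QBasis ι × QBasis ι) :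
    eprVector ι p = if p.1 = p.2 then eprAmplitude ι else 0 := by
  classical
  simp [eprVector, Finset.prod_ite_zero, funext_iff, eprAmplitude]

theorem star_eprAmplitude (ι : Type) [Fintype ι] : star (eprAmplitude ι) = eprAmplitude ι := by
  simp [eprAmplitude]

theorem eprAmplitude_mul_self (ι : Type) [Fintype ι] :
    eprAmplitude ι * eprAmplitude ι * 2 ^ Fintype.card ι = 1 := by
  have h : ((1 / Real.sqrt 2 : ℝ) : ℂ) * ((1 / Real.sqrt 2 : ℝ) : ℂ) * 2 = 1 := by
    have : (1 / Real.sqrt 2) * (1 / Real.sqrt 2) * 2 = 1 := by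
      rw [div_mul_div_comm, Real.mul_self_sqrt (by norm_num)]; norm_num
    exact_mod_cast this
  rw [eprAmplitude, ← mul_pow, ← mul_pow, h, one_pow]

theorem eprState_apply {ι : Type} [Fintype ι] (p q : QBasis ι × QBasis ι) :
    eprState ι p q = if p.1 = p.2 ∧ q.1 = q.2 then eprAmplitude ι * eprAmplitude ι else 0 := by
  rw [eprState, Matrix.vecMulVec_apply, Pi.star_apply, eprVector_apply, eprVector_apply]
  split_ifs <;> simp_all [star_eprAmplitude]

theorem trace_eprState (ι : Type) [Fintype ι] [DecidableEq ι] : (eprState ι).trace = 1 := by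
  simp only [Matrix.trace, Matrix.diag_apply, eprState_apply, and_self, Fintype.sum_prod_type,
    Finset.sum_ite_eq, Finset.mem_univ, if_true, Finset.sum_const, Finset.card_univ,
    Fintype.card_pi, Fintype.card_fin, Finset.prod_const]
  rw [← eprAmplitude_mul_self ι]
  simp [mul_comm]

/-- The EPR vector is the vectorization of a multiple of the identity, so each Kraus operator is
itself the vectorized operator. -/
theorem noisyPairs_eq_mixture {n r : ℕ} (E : Fin r → QOp (Fin n)) :
    noisyPairs E = mixture fun j => eprAmplitude (Fin n) • E j := by
  have h : eprState (Fin n) = mixture fun _ : Fin 1 => eprAmplitude (Fin n) • 1 := by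
    have h2 : eprVector (Fin n) = (eprAmplitude (Fin n) • (1 : QOp (Fin n))).vec := by
      ext p
      simp [eprVector_apply, Matrix.vec, Matrix.one_apply, eq_comm]
    simp [mixture, eprState, h2]
  rw [noisyPairs, h]
  simp only [kronecker_mul_mixture]
  simp [mixture]

theorem trace_keepPairs {n : ℕ} (K : Finset (Fin n)) (ρ : PairOp (Fin n)) :
    (keepPairs K ρ).trace = ρ.trace := by
  let e := (Equiv.piEquivPiSubtypeProd (fun i => i ∈ K) fun _ => Fin 2).symm
  have he : ∀ x u, glue K x u = e (x, u) := fun x u => rfl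
  simp only [Matrix.trace, Matrix.diag_apply, keepPairs, Matrix.of_apply, he,
    Fintype.sum_prod_type]
  calc _ = ∑ x, ∑ u, ∑ y, ∑ v, ρ (e (x, u), e (y, v)) (e (x, u), e (y, v)) :=
        Finset.sum_congr rfl fun x _ => Finset.sum_comm
    _ = ∑ a, ∑ b, ρ (e a, e b) (e a, e b) := by simp only [Fintype.sum_prod_type]
    _ = ∑ a, ∑ b, ρ (e a, b) (e a, b) :=
        Finset.sum_congr rfl fun a _ => e.sum_comp fun b => ρ (e a, b) (e a, b)
    _ = _ := e.sum_comp fun a => ∑ b, ρ (a, b) (a, b)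

/-- `N` is the identity on the qubits in `K` tensored with some operator on the others. -/
def IsIdOn {n : ℕ} (K : Finset (Fin n)) (N : QOp (Fin n)) : Prop :=
  ∃ χ : QOp {i // i ∉ K}, ∀ x y u v,
    N (glue K y v) (glue K x u) = if x = y then χ v u else 0

/-- Entrywise comparison gives some multiple of the EPR state. The factor must be the trace, because
the partial trace preserves it and the EPR state has trace 1. -/
theorem keepPairs_mixture {n r : ℕ} {K : Finset (Fin n)} {N : Fin r → QOp (Fin n)}
    (h : ∀ j, IsIdOn K (N j)) :
    keepPairs K (mixture N) = (mixture N).trace • eprState {i // i ∈ K} := by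
  choose χ hχ using h
  obtain ⟨c, hc⟩ : ∃ c : ℂ, keepPairs K (mixture N) = c • eprState {i // i ∈ K} := by
    refine ⟨(∑ u, ∑ v, ∑ j, χ j v u * star (χ j v u)) * 2 ^ Fintype.card {i // i ∈ K}, ?_⟩
    ext p q
    have h3 := eprAmplitude_mul_self {i // i ∈ K}
    simp only [keepPairs, mixture, Matrix.of_apply, Matrix.sum_apply, Matrix.vecMulVec_apply,
      Pi.star_apply, Matrix.vec, hχ, Matrix.smul_apply, eprState_apply, smul_eq_mul]
    by_cases h1 : p.1 = p.2 <;> by_cases h2 : q.1 = q.2 <;> simp [h1, h2]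
    rw [mul_assoc, mul_comm (2 ^ _) (_ * _)]
    simp only [Fintype.card_coe] at h3
    rw [h3, mul_one]
  have h4 := congrArg Matrix.trace hc
  rw [trace_keepPairs, Matrix.trace_smul, trace_eprState, smul_eq_mul, mul_one] at h4
  rw [hc, h4]

/-! ### Purification as a linear condition on one operator -/

namespace EPP

variable {n : ℕ}

/-- Every branch of the protocol retains at least `k` pairs. -/
def KeepsAtLeast (k : ℕ) : EPP n → Prop
  | finish s => k ≤ s.kept.card
  | measure _ next => ∀ a b, (next a b).KeepsAtLeast k

/-- Started in the vectorization of `M`, the protocol yields perfect EPR pairs. -/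
def Purifies : EPP n → QOp (Fin n) → Prop
  | finish s, M => IsIdOn s.kept ((s.UB : QOp (Fin n)) * M * (s.UA : QOp (Fin n)).transpose)
  | measure P next, M => ∀ a b, (next a b).Purifies (P.proj b * M * (P.proj a).transpose)

theorem Purifies.yields {k r : ℕ} {p : EPP n} (hp : p.KeepsAtLeast k) {M : Fin r → QOp (Fin n)}
    (h : ∀ j, p.Purifies (M j)) : p.Yields k (mixture M) := by
  induction p generalizing M with
  | finish s =>
    refine ⟨hp, ?_⟩
    have htr : (((s.UA : QOp (Fin n)) ⊗ₖ (s.UB : QOp (Fin n))) * mixture M *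
        ((s.UA : QOp (Fin n)) ⊗ₖ (s.UB : QOp (Fin n))).conjTranspose).trace =
          (mixture M).trace := by
      rw [Matrix.trace_mul_cycle, Matrix.conjTranspose_kronecker, ← Matrix.mul_kronecker_mul]
      have h1 : (s.UA : QOp (Fin n)).conjTranspose * (s.UA : QOp (Fin n)) = 1 :=
        (Matrix.mem_unitaryGroup_iff'.1 s.UA.2)
      have h2 : (s.UB : QOp (Fin n)).conjTranspose * (s.UB : QOp (Fin n)) = 1 :=
        (Matrix.mem_unitaryGroup_iff'.1 s.UB.2)
      rw [h1, h2, Matrix.one_kronecker_one, one_mul]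
    rw [← htr, kronecker_mul_mixture]
    exact keepPairs_mixture h
  | measure P next ih =>
    intro a b
    have h1 : P.proj a ⊗ₖ P.proj b = (P.proj a ⊗ₖ P.proj b).conjTranspose := by
      rw [Matrix.conjTranspose_kronecker, P.proj_conjTranspose, P.proj_conjTranspose]
    nth_rewrite 2 [h1]
    rw [kronecker_mul_mixture]
    exact ih a b (hp a b) fun j => h j a b

theorem Purifies.zero (p : EPP n) : p.Purifies 0 := by
  induction p with
  | finish s => exact ⟨0, by simp⟩
  | measure P next ih => intro a b; simpa using ih a b

/-- The branches and final steps depend on outcomes only, never on the error, so on each branch the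
condition is linear in `M`. -/
theorem Purifies.add {p : EPP n} {M N : QOp (Fin n)} (hM : p.Purifies M) (hN : p.Purifies N) :
    p.Purifies (M + N) := by
  induction p generalizing M N with
  | finish s =>
    obtain ⟨χ, hχ⟩ := hM
    obtain ⟨ξ, hξ⟩ := hN
    refine ⟨χ + ξ, fun x y u v => ?_⟩
    rw [mul_add, add_mul, Matrix.add_apply, hχ, hξ]
    split_ifs <;> simp
  | measure P next ih =>
    intro a b
    rw [mul_add, add_mul]
    exact ih a b (hM a b) (hN a b)

theorem Purifies.smul {p : EPP n} {M : QOp (Fin n)} (c : ℂ) (hM : p.Purifies M) :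
    p.Purifies (c • M) := by
  induction p generalizing M with
  | finish s =>
    obtain ⟨χ, hχ⟩ := hM
    refine ⟨c • χ, fun x y u v => ?_⟩
    rw [mul_smul_comm, smul_mul_assoc, Matrix.smul_apply, hχ]
    split_ifs <;> simp
  | measure P next ih =>
    intro a b
    rw [mul_smul_comm, smul_mul_assoc]
    exact ih a b (hM a b)

/-- Arbitrary errors on one qubit are corrected if the operators `1`, `X`, `Z` and `XZ` are. -/
theorem corrects_one {k : ℕ} {p : EPP n} (hp : p.KeepsAtLeast k) (hn : 0 < n)
    (h : ∀ (t : Fin n) (a c : Fin 2), p.Purifies (xOp (Pi.single t a) * zOp (Pi.single t c))) :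
    p.Corrects 1 k := by
  intro T hT r E hE _
  rw [noisyPairs_eq_mixture]
  refine Purifies.yields hp fun j => Purifies.smul _ ?_
  -- If `T` is empty any qubit serves as `t`.
  obtain ⟨t, ht⟩ : ∃ t, ∀ i, i ≠ t → i ∉ T := by
    rcases T.eq_empty_or_nonempty with rfl | ⟨t, ht⟩
    · exact ⟨⟨0, hn⟩, by simp⟩
    · exact ⟨t, fun i hi hiT => hi (Finset.card_le_one.1 hT i hiT t ht)⟩
  obtain ⟨M, hM⟩ := hE j
  have key : ∃ f : Fin 2 → Fin 2 → ℂ, ∀ x y : QBasis (Fin n),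
      E j x y = if ∀ i, i ≠ t → x i = y i then f (x t) (y t) else 0 := by
    by_cases htT : t ∈ T
    · have hT' : ∀ i, i ∉ T ↔ i ≠ t := fun i => ⟨fun h1 h2 => h1 (h2 ▸ htT), ht i⟩
      refine ⟨fun a b => M (fun _ => a) (fun _ => b), fun x y => ?_⟩
      have hT2 : ∀ i : {i // i ∈ T}, i.1 = t := fun i => by
        by_contra h; exact ht _ h i.2
      simp only [hM, hT', hT2]
    · have hT' : ∀ i, i ∉ T := fun i => if hi : i = t then hi ▸ htT else ht i hi
      refine ⟨fun a b => if a = b then M (fun i => (hT' _ i.2).elim) (fun i => (hT' _ i.2).elim)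
        else 0, fun x y => ?_⟩
      rw [hM, ← ite_and]
      have h1 : (∀ i, i ∉ T → x i = y i) ↔ ((∀ i, i ≠ t → x i = y i) ∧ x t = y t) :=
        ⟨fun h => ⟨fun i _ => h i (hT' i), h t (hT' t)⟩, fun h i _ =>
          if hi : i = t then hi ▸ h.2 else h.1 i hi⟩
      simp only [h1]
      split_ifs
      · congr 1 <;> exact funext fun i => (hT' _ i.2).elim
      · rfl
  obtain ⟨f, hf⟩ := key
  -- For a shift `a`, the entries `f a 0` and `f (a + 1) 1` form a diagonal matrix times `X ^ a`.
  -- Half their sum and half their difference are its coefficients on 1 and Z.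
  have hE2 : E j = ∑ a : Fin 2, ∑ c : Fin 2, ((f a 0 + sgn c * f (a + 1) 1) / 2) •
      (xOp (Pi.single t a) * zOp (Pi.single t c)) := by
    ext x y
    have hx : ∀ a : Fin 2, (x = y + Pi.single t a) ↔ (∀ i, i ≠ t → x i = y i) ∧ x t = y t + a := by
      intro a
      rw [funext_iff]
      refine ⟨fun h => ⟨fun i hi => ?_, ?_⟩, fun h i => ?_⟩
      · simpa [hi] using h i
      · simpa using h t
      · by_cases hi : i = t
        · subst hi; simpa using h.2
        · simpa [hi] using h.1 i hi
    rw [hf]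
    simp only [Fin.sum_univ_two, Matrix.add_apply, Matrix.smul_apply, zOp, Matrix.mul_diagonal,
      xOp_apply, hx, chi_comm _ y, chi_single, smul_eq_mul]
    by_cases hxy : ∀ i, i ≠ t → x i = y i
    · simp only [eq_true hxy, true_and, if_true]
      generalize x t = α
      generalize y t = β
      fin_cases α <;> fin_cases β <;> simp <;> ring
    · simp only [eq_false hxy, false_and, if_false]; simp
  rw [hE2]
  simp only [Fin.sum_univ_two]
  exact (((h t 0 0).smul _).add ((h t 0 1).smul _)).add (((h t 1 0).smul _).add ((h t 1 1).smul _))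

end EPP

/-! ### Bilateral decoding by a linear reversible map -/

section Decoding

variable {n : ℕ}

/-- Commuting with each Z on `K` kills the entries between different labels on `K`. Commuting with
each X-product on `K` makes the rest independent of the common label. -/
theorem IsIdOn.of_commute {K : Finset (Fin n)} {N : QOp (Fin n)}
    (hX : ∀ z : QBasis (Fin n), (∀ i ∉ K, z i = 0) → xOp z * N = N * xOp z)
    (hZ : ∀ i ∈ K, Matrix.diagonal (fun x : QBasis (Fin n) => sgn (x i)) * N =
      N * Matrix.diagonal fun x : QBasis (Fin n) => sgn (x i)) : IsIdOn K N := by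
  refine ⟨Matrix.of fun v u => N (glue K 0 v) (glue K 0 u), fun x y u v => ?_⟩
  split_ifs with hxy
  · subst hxy
    have hz : ∀ i ∉ K, glue K x 0 i = 0 := fun i hi => by simp [glue, hi]
    have hg : ∀ w, glue K x w = glue K 0 w + glue K x 0 := fun w => by
      ext i; simp only [glue, Pi.add_apply]; split_ifs <;> simp
    have h := congrFun (congrFun (hX _ hz) (glue K x v)) (glue K 0 u)
    rw [xOp_mul_apply, mul_xOp_apply, ← hg, hg v, add_assoc, QBasis.add_self, add_zero] at h
    rw [Matrix.of_apply, h, hg v]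
  · obtain ⟨i, hi⟩ := Function.ne_iff.1 hxy
    have h := congrFun (congrFun (hZ i.1 i.2) (glue K y v)) (glue K x u)
    rw [Matrix.diagonal_mul, Matrix.mul_diagonal] at h
    have hy : glue K y v i.1 = y i := by simp [glue]
    have hx : glue K x u i.1 = x i := by simp [glue]
    rw [hx, hy, mul_comm, ← sub_eq_zero, ← mul_sub] at h
    refine (mul_eq_zero.1 h).resolve_right fun h2 => hi ?_
    exact (sgn_injective (sub_eq_zero.1 h2)).symm

/-- The operators that `φ` maps to the operators `X` and `Z` on the qubits in `K`. -/
def logicals (φ : QBasis (Fin n) ≃+ QBasis (Fin n)) (K : Finset (Fin n)) : Set (QOp (Fin n)) :=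
  {A | ∃ z : QBasis (Fin n), (∀ i ∉ K, z i = 0) ∧ A = xOp (φ.symm z)} ∪
    {A | ∃ i ∈ K, A = Matrix.diagonal fun x => sgn (φ x i)}

/-- The operators that `φ` maps to operators acting trivially on `K`. -/
def decoupled (φ : QBasis (Fin n) ≃+ QBasis (Fin n)) (K : Finset (Fin n)) :
    Subalgebra ℂ (QOp (Fin n)) :=
  Subalgebra.centralizer ℂ (logicals φ K)

theorem mem_decoupled {φ : QBasis (Fin n) ≃+ QBasis (Fin n)} {K : Finset (Fin n)}
    {M : QOp (Fin n)} :
    M ∈ decoupled φ K ↔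
      (∀ z : QBasis (Fin n), (∀ i ∉ K, z i = 0) → xOp (φ.symm z) * M = M * xOp (φ.symm z)) ∧
        ∀ i ∈ K, Matrix.diagonal (fun x => sgn (φ x i)) * M =
          M * Matrix.diagonal fun x => sgn (φ x i) := by
  rw [decoupled, Subalgebra.mem_centralizer_iff]
  constructor
  · exact fun h => ⟨fun z hz => h _ (Or.inl ⟨z, hz, rfl⟩), fun i hi => h _ (Or.inr ⟨i, hi, rfl⟩)⟩
  · rintro ⟨h1, h2⟩ A (⟨z, hz, rfl⟩ | ⟨i, hi, rfl⟩)
    exacts [h1 z hz, h2 i hi]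

theorem xOp_mem_decoupled {φ : QBasis (Fin n) ≃+ QBasis (Fin n)} {K : Finset (Fin n)}
    {v : QBasis (Fin n)} (h : ∀ i ∈ K, φ v i = 0) : xOp v ∈ decoupled φ K := by
  refine mem_decoupled.2 ⟨fun z _ => xOp_commute _ _, fun i hi => ?_⟩
  rw [diagonal_mul_xOp (ε := 1), one_smul]
  intro x
  rw [map_add, Pi.add_apply, h i hi, add_zero, one_mul]

/-- Z-products transform by the inverse transpose of `φ`. The hypothesis expresses triviality on `K`
dually, by pairing with labels whose image is supported on `K`. -/
theorem zOp_mem_decoupled {φ : QBasis (Fin n) ≃+ QBasis (Fin n)} {K : Finset (Fin n)}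
    {w : QBasis (Fin n)} (h : ∀ z : QBasis (Fin n), (∀ i ∉ K, φ z i = 0) → chi w z = 1) :
    zOp w ∈ decoupled φ K := by
  refine mem_decoupled.2 ⟨fun z hz => ?_, fun i _ => diagonal_commute _ _⟩
  rw [xOp_mul_zOp, h _ (by simpa using hz), one_smul]

theorem proj_mem_decoupled {φ : QBasis (Fin n) ≃+ QBasis (Fin n)} {K : Finset (Fin n)}
    {P : PauliString n} (h : P.toMatrix ∈ decoupled φ K) (a : Bool) :
    P.proj a ∈ decoupled φ K :=
  Subalgebra.smul_mem _ (add_mem (one_mem _) (Subalgebra.smul_mem _ h _)) _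

/-- The unitary that permutes the computational basis by `φ`. -/
def permUnitary (φ : QBasis (Fin n) ≃+ QBasis (Fin n)) :
    Matrix.unitaryGroup (QBasis (Fin n)) ℂ :=
  ⟨(1 : QOp (Fin n)).submatrix φ.symm id, by
    rw [Matrix.mem_unitaryGroup_iff, Matrix.star_eq_conjTranspose, Matrix.conjTranspose_submatrix,
      Matrix.conjTranspose_one]
    ext x y
    simp [Matrix.mul_apply, Matrix.one_apply]⟩

theorem permUnitary_mul_mul_transpose (φ : QBasis (Fin n) ≃+ QBasis (Fin n))
    (M : QOp (Fin n)) :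
    (permUnitary φ : QOp (Fin n)) * M * (permUnitary φ : QOp (Fin n)).transpose =
      M.submatrix φ.symm φ.symm := by
  ext x y
  simp [permUnitary, Matrix.mul_apply, Matrix.one_apply]

/-- The bit flips on the support of `u`. -/
def flipUnitary (u : QBasis (Fin n)) : Matrix.unitaryGroup (QBasis (Fin n)) ℂ :=
  ⟨xOp u, by
    have h : (xOp u).conjTranspose = xOp u := by
      ext x y
      simp only [Matrix.conjTranspose_apply, xOp_apply, QBasis.eq_add_iff (x := x)]
      split_ifs <;> simp
    rw [Matrix.mem_unitaryGroup_iff, Matrix.star_eq_conjTranspose, h, xOp_mul_self]⟩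

/-- Bob flips the bits in the support of `u`, both parties apply `φ`, and the pairs in `K` are
kept. -/
def decodeStep (φ : QBasis (Fin n) ≃+ QBasis (Fin n)) (K : Finset (Fin n))
    (u : QBasis (Fin n)) : FinalStep n where
  UA := permUnitary φ
  UB := permUnitary φ * flipUnitary u
  kept := K

/-- As both parties apply the same real permutation, the operator is conjugated by it, and this
carries the logical operators to X and Z on `K`. -/
theorem purifies_decodeStep {φ : QBasis (Fin n) ≃+ QBasis (Fin n)} {K : Finset (Fin n)}
    {u : QBasis (Fin n)} {M : QOp (Fin n)} (h : xOp u * M ∈ decoupled φ K) :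
    (EPP.finish (decodeStep φ K u)).Purifies M := by
  have key : ∀ N : QOp (Fin n), N ∈ decoupled φ K → IsIdOn K (N.submatrix φ.symm φ.symm) := by
    intro N hN
    obtain ⟨h1, h2⟩ := mem_decoupled.1 hN
    have hmul : ∀ A B : QOp (Fin n), A.submatrix φ.symm φ.symm * B.submatrix φ.symm φ.symm =
        (A * B).submatrix φ.symm φ.symm := fun A B =>
      Matrix.submatrix_mul_equiv A B φ.symm φ.symm.toEquiv φ.symm
    apply IsIdOn.of_commute
    · intro z hz
      have hz2 : xOp z = (xOp (φ.symm z)).submatrix φ.symm φ.symm := by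
        ext x y
        simp [xOp_apply, ← map_add]
      rw [hz2, hmul, hmul, h1 z hz]
    · intro i hi
      have hi2 : (Matrix.diagonal fun x : QBasis (Fin n) => sgn (x i)) =
          (Matrix.diagonal fun x => sgn (φ x i)).submatrix φ.symm φ.symm := by
        ext x y
        simp [Matrix.diagonal_apply]
      rw [hi2, hmul, hmul, h2 i hi]
  have h3 := key _ h
  rw [← permUnitary_mul_mul_transpose, ← mul_assoc] at h3
  exact h3

/-- An injective additive map of a register to itself, as an additive equivalence. -/
def addEquivOfInjective (φ : QBasis (Fin n) →+ QBasis (Fin n)) (h : Function.Injective φ) :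
    QBasis (Fin n) ≃+ QBasis (Fin n) :=
  AddEquiv.ofBijective φ (Finite.injective_iff_bijective.1 h)

theorem addEquivOfInjective_apply (φ : QBasis (Fin n) →+ QBasis (Fin n))
    (h : Function.Injective φ) (x : QBasis (Fin n)) : addEquivOfInjective φ h x = φ x := rfl

end Decoding

/-! ### The one-error protocol -/

/-- The number whose binary digits are read off from the outcomes: the digit is `0` if the outcomes
differ and `1` if they agree. -/
def outcomeCode (h : List (Bool × Bool)) : ℕ :=
  h.foldl (fun c p => 2 * c + if p.1 ≠ p.2 then 0 else 1) 0

theorem outcomeCode_append (h : List (Bool × Bool)) (p : Bool × Bool) :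
    outcomeCode (h ++ [p]) = 2 * outcomeCode h + if p.1 ≠ p.2 then 0 else 1 := by
  simp [outcomeCode]

theorem Nat.div_two_pow_eq_iff (x y s : ℕ) :
    x / 2 ^ s = y / 2 ^ s ↔
      x / 2 ^ (s + 1) = y / 2 ^ (s + 1) ∧ x.testBit s = y.testBit s := by
  rw [pow_succ, ← Nat.div_div_eq_div_mul, ← Nat.div_div_eq_div_mul,
    Nat.testBit_eq_decide_div_mod_eq, Nat.testBit_eq_decide_div_mod_eq, decide_eq_decide]
  omega

theorem Nat.div_two_pow_eq (x s : ℕ) :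
    x / 2 ^ s = 2 * (x / 2 ^ (s + 1)) + if x.testBit s = false then 0 else 1 := by
  rw [pow_succ, ← Nat.div_div_eq_div_mul]
  simp only [Nat.testBit_eq_decide_div_mod_eq, decide_eq_false_iff_not]
  split_ifs <;> omega

theorem sgn_sum {ι : Type} (S : Finset ι) (f : ι → Fin 2) :
    sgn (∑ i ∈ S, f i) = ∏ i ∈ S, sgn (f i) := by
  classical
  induction S using Finset.induction_on with
  | empty => simp
  | insert a s ha ih => rw [Finset.sum_insert ha, Finset.prod_insert ha, sgn_add, ih]

theorem chi_ind {n : ℕ} (S : Finset (Fin n)) (x : QBasis (Fin n)) :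
    chi (ind S) x = sgn (∑ i ∈ S, x i) := by
  rw [sgn_sum, chi, ← Finset.prod_subset (Finset.subset_univ S)]
  · exact Finset.prod_congr rfl fun i hi => by simp [ind, hi]
  · intro i _ hi; simp [ind, hi]

/-! ### Decoding after the binary search -/

section Search

variable {m : ℕ}

/-- The number of final steps of the search for an error in `{2 * c, 2 * c + 1}` after which `i`
is still a candidate. -/
def searchKey (c : ℕ) (i : Fin (2 ^ m - 1)) : ℕ := Nat.size (i.val / 2 ^^^ c)

/-- The size of the XOR is the position just above the highest digit in which the two numbers
differ. -/
theorem searchKey_le_iff {c s : ℕ} {i : Fin (2 ^ m - 1)} :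
    searchKey c i ≤ s ↔ i.val / 2 / 2 ^ s = c / 2 ^ s := by
  rw [searchKey, Nat.size_le, ← Nat.xor_eq_zero_iff (x := i.val / 2 / 2 ^ s),
    ← Nat.shiftRight_eq_div_pow, ← Nat.shiftRight_eq_div_pow, ← Nat.shiftRight_xor_distrib,
    Nat.shiftRight_eq_div_pow, Nat.div_eq_zero_iff]
  simp

variable [NeZero (2 ^ m - 1)]

/-- A representative of the pairs with a given key. -/
def searchRep (c l : ℕ) : Fin (2 ^ m - 1) := Function.invFun (searchKey c) l

theorem searchKey_searchRep (c : ℕ) (i : Fin (2 ^ m - 1)) :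
    searchKey c (searchRep c (searchKey c i) : Fin (2 ^ m - 1)) = searchKey c i :=
  Function.invFun_eq ⟨i, rfl⟩

/-- The pairs discarded after the search for an error in `{2 * c, 2 * c + 1}`: these two, and one
pair out of each rejected half. -/
def searchDiscard (m : ℕ) [NeZero (2 ^ m - 1)] (c : ℕ) : Finset (Fin (2 ^ m - 1)) :=
  Finset.univ.filter (fun i => i.val / 2 = c) ∪ (Finset.Icc 1 (m - 1)).image (searchRep c)

theorem card_searchDiscard (hm : 1 ≤ m) (c : ℕ) : (searchDiscard m c).card ≤ m + 1 := by
  have h1 : (Finset.univ.filter fun i : Fin (2 ^ m - 1) => i.val / 2 = c).card ≤ 2 := by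
    rw [← Finset.card_map Fin.valEmbedding]
    refine (Finset.card_le_card (t := {2 * c, 2 * c + 1}) ?_).trans Finset.card_le_two
    intro x hx
    simp only [Finset.mem_map, Finset.mem_filter, Fin.valEmbedding_apply] at hx
    obtain ⟨i, hi, rfl⟩ := hx
    simp only [Finset.mem_insert, Finset.mem_singleton]
    omega
  have h2 : ((Finset.Icc 1 (m - 1)).image (searchRep (m := m) c)).card ≤ m - 1 :=
    Finset.card_image_le.trans (by simp)
  have h3 := Finset.card_union_le (Finset.univ.filter fun i : Fin (2 ^ m - 1) => i.val / 2 = c)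
    ((Finset.Icc 1 (m - 1)).image (searchRep c))
  rw [searchDiscard]
  omega

theorem searchRep_mem_searchDiscard {c : ℕ} (hc : c < 2 ^ (m - 1)) {i : Fin (2 ^ m - 1)}
    (hi : i ∉ searchDiscard m c) : searchRep c (searchKey c i) ∈ searchDiscard m c := by
  simp only [searchDiscard, Finset.mem_union, Finset.mem_filter, Finset.mem_univ, true_and,
    not_or] at hi
  refine Finset.mem_union_right _ (Finset.mem_image_of_mem _ (Finset.mem_Icc.2 ⟨?_, ?_⟩))
  · by_contra h
    have h0 : searchKey c i ≤ 0 := by omega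
    rw [searchKey_le_iff] at h0
    exact hi.1 (by simpa using h0)
  · have hi2 : i.val / 2 < 2 ^ (m - 1) := by
      have h1 := i.isLt
      have h2 : 2 ^ m ≤ 2 ^ (m - 1) * 2 := by
        rw [← pow_succ]; exact Nat.pow_le_pow_right (by norm_num) (by omega)
      omega
    rw [searchKey_le_iff, Nat.div_eq_of_lt hc, Nat.div_eq_of_lt hi2]

/-- To every kept pair the representative of its key is added. -/
def searchHom (c : ℕ) : QBasis (Fin (2 ^ m - 1)) →+ QBasis (Fin (2 ^ m - 1)) where
  toFun x i := if i ∈ searchDiscard m c then x i else x i + x (searchRep c (searchKey c i))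
  map_zero' := by ext i; simp
  map_add' x y := by
    ext1 i
    simp only [Pi.add_apply]
    split_ifs
    · rfl
    · exact add_add_add_comm _ _ _ _

/-- The map is triangular: representatives are discarded, so their bits stay unchanged and can be
subtracted again. -/
theorem searchHom_injective {c : ℕ} (hc : c < 2 ^ (m - 1)) :
    Function.Injective (searchHom (m := m) c) := by
  rw [injective_iff_map_eq_zero]
  intro x hx
  have h1 : ∀ i ∈ searchDiscard m c, x i = 0 := fun i hi => by
    simpa [searchHom, hi] using congrFun hx i
  ext1 i
  by_cases hi : i ∈ searchDiscard m c
  · exact h1 i hi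
  · simpa [searchHom, hi, h1 _ (searchRep_mem_searchDiscard hc hi)] using congrFun hx i

/-- The decoding map after the search for an error in `{2 * c, 2 * c + 1}`. -/
def searchEquiv (c : Fin (2 ^ (m - 1))) :
    QBasis (Fin (2 ^ m - 1)) ≃+ QBasis (Fin (2 ^ m - 1)) :=
  addEquivOfInjective (searchHom c.val) (searchHom_injective c.isLt)

/-- A union of key classes contains a kept pair exactly when it contains its representative, so the
two flips cancel. -/
theorem xOp_ind_mem_decoupled_search {c : Fin (2 ^ (m - 1))} {S : Finset (Fin (2 ^ m - 1))}
    (hS : ∀ i j, searchKey c i = searchKey c j → i ∈ S → j ∈ S) :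
    xOp (ind S) ∈ decoupled (searchEquiv c) (searchDiscard m c)ᶜ := by
  refine xOp_mem_decoupled fun i hi => ?_
  have h1 : searchRep c.val (searchKey c.val i) ∈ S ↔ i ∈ S :=
    ⟨hS _ _ (searchKey_searchRep _ _), hS _ _ (searchKey_searchRep _ _).symm⟩
  simp only [searchEquiv, addEquivOfInjective_apply, searchHom, AddMonoidHom.coe_mk,
    ZeroHom.coe_mk, if_neg (Finset.mem_compl.1 hi), ind, h1]
  exact Fin.two_add_self _

/-- A final candidate has key 0. Kept pairs have nonzero keys, so it is neither kept nor added to a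
kept pair. -/
theorem xOp_single_mem_decoupled_search {c : Fin (2 ^ (m - 1))} {t : Fin (2 ^ m - 1)}
    (ht : t.val / 2 = c) (a : Fin 2) :
    xOp (Pi.single t a) ∈ decoupled (searchEquiv c) (searchDiscard m c)ᶜ := by
  refine xOp_mem_decoupled fun i hi => ?_
  have h0 : searchKey c.val t = 0 := Nat.le_zero.1 (searchKey_le_iff.2 (by simpa using ht))
  have hi' := hi
  simp only [searchDiscard, Finset.mem_compl, Finset.mem_union, Finset.mem_filter,
    Finset.mem_univ, true_and, not_or] at hi'
  have h1 : i ≠ t := fun h => hi'.1 (h ▸ ht)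
  have h2 : searchRep c.val (searchKey c.val i) ≠ t := fun h => by
    have h3 := searchKey_searchRep c.val i
    rw [h, h0] at h3
    have h4 := searchKey_le_iff.1 h3.symm.le
    exact hi'.1 (by simpa using h4)
  simp [searchEquiv, addEquivOfInjective_apply, searchHom, Finset.mem_compl.1 hi, h1, h2]

theorem zOp_single_mem_decoupled_search {c : Fin (2 ^ (m - 1))} {t : Fin (2 ^ m - 1)}
    (ht : t.val / 2 = c) (a : Fin 2) :
    zOp (Pi.single t a) ∈ decoupled (searchEquiv c) (searchDiscard m c)ᶜ := by
  have ht2 : t ∈ searchDiscard m c := Finset.mem_union_left _ (by simp [ht])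
  refine zOp_mem_decoupled fun z hz => ?_
  have h := hz t (by simpa using ht2)
  simp only [searchEquiv, addEquivOfInjective_apply, searchHom, AddMonoidHom.coe_mk,
    ZeroHom.coe_mk, if_pos ht2] at h
  rw [chi_comm, chi_single, h, zero_mul, sgn_zero]

end Search

/-! ### Decoding after the Hamming checks -/

section Hamming

variable {m : ℕ}

/-- The pairs that enter the parity check of the digit `s`. -/
def hammingSet (m s : ℕ) : Finset (Fin (2 ^ m - 1)) :=
  Finset.univ.filter fun i => i.val.testBit s = false

/-- The numbers of which a single digit is `0`. -/
def hammingPivots (m : ℕ) : Finset ℕ := (Finset.range m).image fun s => 2 ^ m - (2 ^ s + 1)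

/-- The pairs discarded after the parity checks. -/
def hammingDiscard (m : ℕ) : Finset (Fin (2 ^ m - 1)) :=
  Finset.univ.filter fun i => i.val ∈ insert 0 (hammingPivots m)

theorem card_hammingDiscard : (hammingDiscard m).card ≤ m + 1 := by
  rw [← Finset.card_map Fin.valEmbedding]
  refine (Finset.card_le_card (t := insert 0 (hammingPivots m)) ?_).trans ?_
  · intro x hx
    simp only [Finset.mem_map, hammingDiscard, Finset.mem_filter, Fin.valEmbedding_apply] at hx
    obtain ⟨i, hi, rfl⟩ := hx
    exact hi.2
  · refine (Finset.card_insert_le _ _).trans (Nat.succ_le_succ ?_)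
    exact Finset.card_image_le.trans (by simp)

theorem testBit_hammingPivot {m s : ℕ} (hs : s < m) (j : ℕ) :
    (2 ^ m - (2 ^ s + 1)).testBit j = (decide (j < m) && !decide (s = j)) := by
  rw [Nat.testBit_two_pow_sub_succ (Nat.pow_lt_pow_right (by norm_num) hs), Nat.testBit_two_pow]

theorem log2_hammingPivot {m s : ℕ} (hs : s < m) :
    (2 ^ m - 1 - (2 ^ m - (2 ^ s + 1))).log2 = s := by
  have h : 2 ^ s < 2 ^ m := Nat.pow_lt_pow_right (by norm_num) hs
  have h2 : 2 ^ m - 1 - (2 ^ m - (2 ^ s + 1)) = 2 ^ s := by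
    generalize 2 ^ s = a at *
    omega
  rw [h2, Nat.log2_two_pow]

theorem zero_notMem_hammingPivots (hm : 2 ≤ m) : 0 ∉ hammingPivots m := by
  intro h
  simp only [hammingPivots, Finset.mem_image, Finset.mem_range] at h
  obtain ⟨s, hs, h⟩ := h
  obtain ⟨j, hj, hjs⟩ : ∃ j < m, s ≠ j := by
    by_cases h0 : s = 0
    · exact ⟨1, by omega, by omega⟩
    · exact ⟨0, by omega, h0⟩
  have h2 := testBit_hammingPivot hs j
  rw [h] at h2
  simp [hj, hjs] at h2

/-- Each check has an even number of pairs: flipping another digit `s'` matches them up. This is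
where `m ≥ 2` enters. -/
theorem chi_hammingSet_univ (hm : 2 ≤ m) {s : ℕ} (hs : s < m) :
    chi (ind (hammingSet m s)) (ind Finset.univ) = 1 := by
  obtain ⟨s', hs', hne⟩ : ∃ s' < m, s' ≠ s := by
    by_cases h0 : s = 0
    · exact ⟨1, by omega, by omega⟩
    · exact ⟨0, by omega, by omega⟩
  -- The digit `s` stays 0, so the result is not the missing all-ones number.
  have hflip : ∀ i ∈ hammingSet m s, i.val ^^^ 2 ^ s' < 2 ^ m - 1 := by
    intro i hi
    have h1 : i.val ^^^ 2 ^ s' < 2 ^ m :=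
      Nat.xor_lt_two_pow (by omega) (Nat.pow_lt_pow_right (by norm_num) hs')
    have h2 : i.val ^^^ 2 ^ s' ≠ 2 ^ m - 1 := fun h => by
      have h3 := congrArg (fun x => x.testBit s) h
      have h4 : i.val.testBit s = false := (Finset.mem_filter.1 hi).2
      simp [Nat.testBit_xor, h4, hne, Nat.testBit_two_pow_sub_one, hs] at h3
    omega
  rw [chi_ind, Finset.sum_involution (fun i hi => ⟨i.val ^^^ 2 ^ s', hflip i hi⟩), sgn_zero]
  · intro i hi
    simp only [ind, Finset.mem_univ, if_true]
    rfl
  · intro i hi _ h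
    have h2 := congrArg Fin.val h
    simp at h2
  · intro i hi
    have h4 : i.val.testBit s = false := (Finset.mem_filter.1 hi).2
    simp [hammingSet, Nat.testBit_xor, h4, hne]
  · intro i hi
    ext
    simp

variable [NeZero (2 ^ m - 1)]

/-- The parity checks are written to the pivots, and the qubit `0` is added to the kept ones. -/
def hammingHom (m : ℕ) [NeZero (2 ^ m - 1)] :
    QBasis (Fin (2 ^ m - 1)) →+ QBasis (Fin (2 ^ m - 1)) where
  toFun x i :=
    if i.val ∈ hammingPivots m then ∑ j ∈ hammingSet m (2 ^ m - 1 - i.val).log2, x j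
    else if i = 0 then x 0 else x i + x 0
  map_zero' := by ext i; simp
  map_add' x y := by
    ext1 i
    simp only [Pi.add_apply]
    split_ifs
    · exact Finset.sum_add_distrib
    · rfl
    · exact add_add_add_comm _ _ _ _

theorem hammingHom_pivot {s : ℕ} (hs : s < m) (x : QBasis (Fin (2 ^ m - 1)))
    (i : Fin (2 ^ m - 1)) (hi : i.val = 2 ^ m - (2 ^ s + 1)) :
    hammingHom m x i = ∑ j ∈ hammingSet m s, x j := by
  have h : i.val ∈ hammingPivots m := by
    rw [hi]; exact Finset.mem_image_of_mem _ (Finset.mem_range.2 hs)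
  have h2 : (2 ^ m - 1 - i.val).log2 = s := by rw [hi, log2_hammingPivot hs]
  simp only [hammingHom, AddMonoidHom.coe_mk, ZeroHom.coe_mk, if_pos h, h2]

theorem hammingHom_injective (hm : 2 ≤ m) : Function.Injective (hammingHom m) := by
  rw [injective_iff_map_eq_zero]
  intro x hx
  have h0 : x 0 = 0 := by
    simpa [hammingHom, zero_notMem_hammingPivots hm] using congrFun hx 0
  have h1 : ∀ i : Fin (2 ^ m - 1), i.val ∉ hammingPivots m → x i = 0 := by
    intro i hi
    by_cases hi0 : i = 0
    · rw [hi0, h0]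
    · simpa [hammingHom, hi, hi0, h0] using congrFun hx i
  ext1 i
  by_cases hi : i.val ∈ hammingPivots m
  · obtain ⟨s, hs, hsi⟩ := Finset.mem_image.1 hi
    rw [Finset.mem_range] at hs
    have h2 := hammingHom_pivot hs x i hsi.symm
    -- Check `s` contains no other pivot, and off the pivots `x` already vanishes.
    rw [hx, Finset.sum_eq_single i] at h2
    · exact h2.symm
    · intro j hj hji
      refine h1 j fun hj2 => hji (Fin.ext ?_)
      obtain ⟨s', hs', hsj⟩ := Finset.mem_image.1 hj2
      rw [Finset.mem_range] at hs'
      have h3 : j.val.testBit s = false := (Finset.mem_filter.1 hj).2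
      rw [← hsj, testBit_hammingPivot hs'] at h3
      have h4 : s' = s := by simpa [hs] using h3
      rw [← hsj, ← hsi, h4]
    · intro h3
      refine absurd ?_ h3
      rw [hammingSet, Finset.mem_filter, ← hsi, testBit_hammingPivot hs]
      simp
  · exact h1 i hi

/-- The decoding map after the parity checks. -/
def hammingEquiv (hm : 2 ≤ m) : QBasis (Fin (2 ^ m - 1)) ≃+ QBasis (Fin (2 ^ m - 1)) :=
  addEquivOfInjective (hammingHom m) (hammingHom_injective hm)

theorem xOp_univ_mem_decoupled_hamming (hm : 2 ≤ m) :
    xOp (ind Finset.univ) ∈ decoupled (hammingEquiv hm) (hammingDiscard m)ᶜ := by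
  refine xOp_mem_decoupled fun i hi => ?_
  simp only [hammingDiscard, Finset.mem_compl, Finset.mem_filter, Finset.mem_univ, true_and,
    Finset.mem_insert, not_or] at hi
  have h0 : i ≠ 0 := fun h => hi.1 (by simp [h])
  simp [hammingEquiv, addEquivOfInjective_apply, hammingHom, hi.2, h0, ind]

/-- The parity of check `s` is the bit that the decoding map writes to pivot `s`, which is
discarded. -/
theorem zOp_hammingSet_mem_decoupled (hm : 2 ≤ m) {s : ℕ} (hs : s < m) :
    zOp (ind (hammingSet m s)) ∈ decoupled (hammingEquiv hm) (hammingDiscard m)ᶜ := by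
  refine zOp_mem_decoupled fun z hz => ?_
  have h1 : 2 ^ m - (2 ^ s + 1) < 2 ^ m - 1 := by
    have h2 : 2 ^ s < 2 ^ m := Nat.pow_lt_pow_right (by norm_num) hs
    have h3 : 0 < 2 ^ s := by positivity
    omega
  rw [chi_ind, ← hammingHom_pivot hs z ⟨_, h1⟩ rfl]
  have h2 := hz ⟨_, h1⟩ (by
    simp only [hammingDiscard, Finset.mem_compl, Finset.mem_filter, Finset.mem_univ, true_and,
      not_not]
    exact Finset.mem_insert_of_mem (Finset.mem_image_of_mem _ (Finset.mem_range.2 hs)))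
  rw [hammingEquiv, addEquivOfInjective_apply] at h2
  rw [h2, sgn_zero]

end Hamming

/-! ### Commutation of the measured operators -/

namespace EPP

section Commutation

variable {m : ℕ}

theorem commutesAfter_binarySearch {n : ℕ} (final : List (Bool × Bool) → FinalStep n) (s : ℕ)
    (S : Finset (Fin n)) (l : List (Bool × Bool)) (past : List (PauliString n))
    (h : ∀ Q ∈ past, ∃ T, Q = PauliString.xOn T) :
    (binarySearch final s S l).CommutesAfter past := by
  induction s generalizing S l past with
  | zero => trivial
  | succ s ih =>
    refine ⟨fun Q hQ => ?_, fun a b => ih _ _ _ ?_⟩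
    · obtain ⟨T, rfl⟩ := h Q hQ
      rw [PauliString.toMatrix_xOn, PauliString.toMatrix_xOn]
      exact xOp_commute _ _
    · simp only [List.mem_cons, forall_eq_or_imp]
      exact ⟨⟨_, rfl⟩, h⟩

theorem commutesAfter_hammingChecks (final : List (Bool × Bool) → FinalStep (2 ^ m - 1)) {s : ℕ}
    (hs : s ≤ m) (l : List (Bool × Bool)) (past : List (PauliString (2 ^ m - 1)))
    (h : ∀ Q ∈ past, ∀ j < m, Commute (zOp (ind (hammingSet m j))) Q.toMatrix) :
    (hammingChecks final s l).CommutesAfter past := by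
  induction s generalizing l past with
  | zero => trivial
  | succ s ih =>
    refine ⟨fun Q hQ => ?_, fun a b => ih (by omega) _ _ ?_⟩
    · rw [PauliString.toMatrix_zOn]
      exact h Q hQ s hs
    · simp only [List.mem_cons, forall_eq_or_imp]
      refine ⟨fun j _ => ?_, h⟩
      rw [PauliString.toMatrix_zOn]
      exact zOp_commute _ _

theorem zOp_hammingSet_commute (hm : 2 ≤ m) {s : ℕ} (hs : s < m) :
    Commute (zOp (ind (hammingSet m s))) (PauliString.xOn Finset.univ).toMatrix := by
  rw [PauliString.toMatrix_xOn, Commute, SemiconjBy, zOp_mul_xOp, chi_hammingSet_univ hm hs,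
    one_smul]

theorem isStabilizerEPP_oneErrorProtocol (hm : 2 ≤ m)
    (final : List (Bool × Bool) → FinalStep (2 ^ m - 1)) :
    (oneErrorProtocol m final).IsStabilizerEPP := by
  refine ⟨by simp, fun a b => ?_⟩
  dsimp only
  split_ifs
  · exact commutesAfter_binarySearch _ _ _ _ _ (by simp)
  · refine commutesAfter_hammingChecks _ le_rfl _ _ ?_
    simp only [List.mem_singleton, forall_eq]
    exact fun j hj => zOp_hammingSet_commute hm hj

end Commutation

end EPP

/-! ### Final steps and correctness of the protocol -/

section Protocol

variable {m : ℕ} [NeZero (2 ^ m - 1)]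

/-- The label whose only entry `1` is the one numbered `τ`, if there is one. -/
def flipAt (n τ : ℕ) : QBasis (Fin n) := fun i => if i.val = τ then 1 else 0

theorem flipAt_val {n : ℕ} (t : Fin n) : flipAt n t = Pi.single t 1 := by
  ext1 i
  simp [flipAt, Pi.single_apply, Fin.ext_iff]

theorem flipAt_self (n : ℕ) : flipAt n n = 0 := by
  ext1 i
  simp [flipAt, i.isLt.ne]

/-- The last stage after a binary search. -/
def searchStep (m : ℕ) [NeZero (2 ^ m - 1)] (c : Fin (2 ^ (m - 1))) : FinalStep (2 ^ m - 1) :=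
  decodeStep (searchEquiv c) (searchDiscard m c)ᶜ 0

/-- The last stage after the parity checks. -/
def hammingStep (hm : 2 ≤ m) (τ : ℕ) : FinalStep (2 ^ m - 1) :=
  decodeStep (hammingEquiv hm) (hammingDiscard m)ᶜ (flipAt _ τ)

/-- The last stage of the one-error protocol, as a function of all outcomes. -/
def finalStep (hm : 2 ≤ m) (h : List (Bool × Bool)) : FinalStep (2 ^ m - 1) :=
  if (h.headD (false, false)).1 ≠ (h.headD (false, false)).2 then
    searchStep m ⟨outcomeCode h.tail % 2 ^ (m - 1), Nat.mod_lt _ (by positivity)⟩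
  else hammingStep hm (outcomeCode h.tail)

theorem le_card_finalStep (hm : 2 ≤ m) (h : List (Bool × Bool)) :
    2 ^ m - m - 2 ≤ (finalStep hm h).kept.card := by
  rw [finalStep]
  split_ifs
  · simp only [searchStep, decodeStep, Finset.card_compl, Fintype.card_fin]
    have := card_searchDiscard (m := m) (by omega) (outcomeCode h.tail % 2 ^ (m - 1))
    omega
  · simp only [hammingStep, decodeStep, Finset.card_compl, Fintype.card_fin]
    have := card_hammingDiscard (m := m)
    omega

namespace EPP

/-- Only branches whose outcomes match the commutation sign `c` survive. On the others the operator
is 0, which is trivially purified. -/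
theorem purifies_measure_xOn {n : ℕ} {S : Finset (Fin n)} {next : Bool → Bool → EPP n}
    {M : QOp (Fin n)} {c : Fin 2} (hM : xOp (ind S) * M = sgn c • (M * xOp (ind S)))
    (h : ∀ a b, (a ≠ b ↔ c = 1) → (next a b).Purifies (M * (PauliString.xOn S).proj a)) :
    (measure (PauliString.xOn S) next).Purifies M := by
  intro a b
  have h1 := PauliString.toMatrix_xOn S
  rw [PauliString.proj_transpose (by rw [h1, xOp_transpose]),
    PauliString.proj_mul_mul_proj (c := c) (by rw [h1, xOp_mul_self]) (by rw [h1, hM])]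
  split_ifs with hab
  · exact h a b hab
  · exact Purifies.zero _

theorem purifies_measure_zOn {n : ℕ} {S : Finset (Fin n)} {next : Bool → Bool → EPP n}
    {M : QOp (Fin n)} {c : Fin 2} (hM : zOp (ind S) * M = sgn c • (M * zOp (ind S)))
    (h : ∀ a b, (a ≠ b ↔ c = 1) → (next a b).Purifies (M * (PauliString.zOn S).proj a)) :
    (measure (PauliString.zOn S) next).Purifies M := by
  intro a b
  have h1 := PauliString.toMatrix_zOn S
  rw [PauliString.proj_transpose (by rw [h1, zOp_transpose]),
    PauliString.proj_mul_mul_proj (c := c) (by rw [h1, zOp_mul_self]) (by rw [h1, hM])]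
  split_ifs with hab
  · exact h a b hab
  · exact Purifies.zero _

theorem xOp_commute_proj_xOn {n : ℕ} (v : QBasis (Fin n)) (S : Finset (Fin n)) (a : Bool) :
    Commute (xOp v) ((PauliString.xOn S).proj a) := by
  rw [PauliString.proj, PauliString.toMatrix_xOn]
  exact ((Commute.one_right _).add_right ((xOp_commute _ _).smul_right _)).smul_right _

theorem zOp_commute_proj_zOn {n : ℕ} (w : QBasis (Fin n)) (S : Finset (Fin n)) (a : Bool) :
    Commute (zOp w) ((PauliString.zOn S).proj a) := by
  rw [PauliString.proj, PauliString.toMatrix_zOn]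
  exact ((Commute.one_right _).add_right ((zOp_commute _ _).smul_right _)).smul_right _

/-- The invariant carried through the search: the candidates are the pairs of key at most `s`, the
record spells the leading digits of `c`, and `M` is decoupled and commutes with X-products up to the
same sign as a Z at `t`. -/
theorem purifies_binarySearch (hm : 2 ≤ m) {x : Bool × Bool} (hx : x.1 ≠ x.2)
    {t : Fin (2 ^ m - 1)} {c : Fin (2 ^ (m - 1))} (hc : t.val / 2 = c) {s : ℕ}
    {S : Finset (Fin (2 ^ m - 1))} {l : List (Bool × Bool)} {M : QOp (Fin (2 ^ m - 1))}
    (hS : ∀ i, i ∈ S ↔ searchKey c i ≤ s) (hl : outcomeCode l = c / 2 ^ s)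
    (hM : M ∈ decoupled (searchEquiv c) (searchDiscard m c)ᶜ)
    (hX : ∀ v, xOp v * M = sgn (v t) • (M * xOp v)) :
    (binarySearch (finalStep hm) s S (x :: l)).Purifies M := by
  induction s generalizing S l M with
  | zero =>
    have hf : finalStep hm (x :: l) = searchStep m c := by
      -- The reduction in `finalStep` only serves to index arbitrary records; here the code is `c`,
      -- already in range.
      have h : (⟨outcomeCode l % 2 ^ (m - 1), Nat.mod_lt _ (by positivity)⟩ :
          Fin (2 ^ (m - 1))) = c := Fin.ext (by simp [hl, Nat.mod_eq_of_lt c.isLt])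
      rw [finalStep, List.headD_cons, if_pos hx]
      exact congrArg (searchStep m) h
    rw [binarySearch, hf]
    exact purifies_decodeStep (by simpa using hM)
  | succ s ih =>
    rw [binarySearch]
    have hbit : ∀ i : Fin (2 ^ m - 1), i.val.testBit (s + 1) = (i.val / 2).testBit s := fun i =>
      Nat.testBit_succ _ _
    have hstep : ∀ i : Fin (2 ^ m - 1), searchKey c i ≤ s ↔
        i ∈ S ∧ i.val.testBit (s + 1) = c.val.testBit s := fun i => by
      rw [hS, searchKey_le_iff, searchKey_le_iff, hbit, ← Nat.div_two_pow_eq_iff]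
    have htS : t ∈ S := (hS t).2 (searchKey_le_iff.2 (by rw [hc]))
    have htc : t.val.testBit (s + 1) = c.val.testBit s := by rw [hbit, hc]
    refine purifies_measure_xOn (hX _) fun a b hab => ?_
    have hab' : a ≠ b ↔ c.val.testBit s = false := by
      rw [hab, ind, ← htc]
      simp [htS]
    refine ih ?_ ?_ ?_ ?_
    · intro i
      rw [hstep]
      by_cases h : a ≠ b
      · rw [if_pos h, Finset.mem_filter, hab'.1 h]
      · rw [if_neg h, Finset.mem_filter]
        simp only [hab', Bool.not_eq_false] at h
        rw [h]
    · refine (outcomeCode_append _ _).trans ?_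
      rw [hl, Nat.div_two_pow_eq c.val s]
      simp only [hab']
    · refine mul_mem hM (proj_mem_decoupled ?_ a)
      rw [PauliString.toMatrix_xOn]
      refine xOp_ind_mem_decoupled_search fun i j hij hi => ?_
      have h1 := hstep i
      have h2 := hstep j
      rw [← hij] at h2
      have h3 := hS i
      have h4 := hS j
      rw [← hij] at h4
      rw [Finset.mem_filter] at hi ⊢
      have hj : j ∈ S := h4.2 (h3.1 hi.1)
      refine ⟨hj, ?_⟩
      by_contra hne
      rw [Bool.not_eq_false] at hne
      -- The measured half is the new candidate set if this digit of `c` is 0, and the rejected half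
      -- otherwise. Either is described by the key alone.
      cases hcs : c.val.testBit s
      · have h5 := (h2.1 (h1.2 ⟨hi.1, by rw [hi.2, hcs]⟩)).2
        rw [hne, hcs] at h5
        exact absurd h5 (by simp)
      · have h5 := (h1.1 (h2.2 ⟨hj, by rw [hne, hcs]⟩)).2
        rw [hi.2, hcs] at h5
        exact absurd h5 (by simp)
    · intro v
      rw [← mul_assoc, hX, smul_mul_assoc, mul_assoc, mul_assoc, (xOp_commute_proj_xOn v _ a).eq]

/-- Bob's flip at `τ` is included in the invariant from the start; the remaining factor is a product
of projectors of decoupled operators. -/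
theorem purifies_hammingChecks (hm : 2 ≤ m) {x : Bool × Bool} (hx : x.1 = x.2) {τ s : ℕ}
    (hs : s ≤ m) {l : List (Bool × Bool)} {M : QOp (Fin (2 ^ m - 1))}
    (hl : outcomeCode l = τ / 2 ^ s)
    (hM : xOp (flipAt _ τ) * M ∈ decoupled (hammingEquiv hm) (hammingDiscard m)ᶜ)
    (hZ : ∀ j < m, zOp (ind (hammingSet m j)) * M =
      sgn (if τ.testBit j = false then 1 else 0) • (M * zOp (ind (hammingSet m j)))) :
    (hammingChecks (finalStep hm) s (x :: l)).Purifies M := by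
  induction s generalizing l M with
  | zero =>
    have hf : finalStep hm (x :: l) = hammingStep hm τ := by
      simp [finalStep, hx, hl]
    rw [hammingChecks, hf]
    exact purifies_decodeStep hM
  | succ s ih =>
    rw [hammingChecks]
    refine purifies_measure_zOn (hZ s hs) fun a b hab => ?_
    have hab' : a ≠ b ↔ τ.testBit s = false := by
      rw [hab]; simp
    refine ih (by omega) ?_ ?_ ?_
    · refine (outcomeCode_append _ _).trans ?_
      rw [hl, Nat.div_two_pow_eq τ s]
      simp only [hab']
    · rw [← mul_assoc]
      refine mul_mem hM (proj_mem_decoupled ?_ a)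
      rw [PauliString.toMatrix_zOn]
      exact zOp_hammingSet_mem_decoupled hm hs
    · intro j hj
      rw [← mul_assoc, hZ j hj, smul_mul_assoc, mul_assoc, mul_assoc,
        (zOp_commute_proj_zOn _ _ a).eq]

theorem keepsAtLeast_binarySearch {n k : ℕ} {final : List (Bool × Bool) → FinalStep n}
    (h : ∀ l, k ≤ (final l).kept.card) (s : ℕ) (S : Finset (Fin n)) (l : List (Bool × Bool)) :
    (binarySearch final s S l).KeepsAtLeast k := by
  induction s generalizing S l with
  | zero => exact h l
  | succ s ih => exact fun a b => ih _ _

theorem keepsAtLeast_hammingChecks {n k : ℕ} {final : List (Bool × Bool) → FinalStep n}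
    (h : ∀ l, k ≤ (final l).kept.card) (s : ℕ) (l : List (Bool × Bool)) :
    (hammingChecks final s l).KeepsAtLeast k := by
  induction s generalizing l with
  | zero => exact h l
  | succ s ih => exact fun a b => ih _

theorem keepsAtLeast_oneErrorProtocol (hm : 2 ≤ m) :
    (oneErrorProtocol m (finalStep hm)).KeepsAtLeast (2 ^ m - m - 2) := by
  intro a b
  dsimp only
  split_ifs
  · exact keepsAtLeast_binarySearch (le_card_finalStep hm) _ _ _
  · exact keepsAtLeast_hammingChecks (le_card_finalStep hm) _ _

theorem xOp_mul_error {n : ℕ} (t : Fin n) (e c : Fin 2) (v : QBasis (Fin n)) :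
    xOp v * (xOp (Pi.single t e) * zOp (Pi.single t c)) =
      sgn (c * v t) • (xOp (Pi.single t e) * zOp (Pi.single t c) * xOp v) := by
  rw [← mul_assoc, (xOp_commute v _).eq, mul_assoc, xOp_mul_zOp, chi_comm, chi_single, mul_comm c,
    mul_smul_comm, mul_assoc]

theorem purifies_oneErrorProtocol_phase (hm : 2 ≤ m) (t : Fin (2 ^ m - 1)) (e : Fin 2) :
    (oneErrorProtocol m (finalStep hm)).Purifies
      (xOp (Pi.single t e) * zOp (Pi.single t 1)) := by
  refine purifies_measure_xOn (c := 1) (by rw [xOp_mul_error]; simp [ind]) fun a b hab => ?_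
  have hlt : t.val / 2 < 2 ^ (m - 1) := by
    have h1 := t.isLt
    have h2 : 2 ^ m = 2 ^ (m - 1) * 2 := by rw [← pow_succ]; congr 1; omega
    omega
  have hab1 : a ≠ b := hab.2 rfl
  rw [if_pos hab1]
  refine purifies_binarySearch hm hab1 (t := t) (c := ⟨t.val / 2, hlt⟩) rfl ?_ ?_ ?_ ?_
  · intro i
    have hi : i.val / 2 < 2 ^ (m - 1) := by
      have h1 := i.isLt
      have h2 : 2 ^ m = 2 ^ (m - 1) * 2 := by rw [← pow_succ]; congr 1; omega
      omega
    simp [searchKey_le_iff, Nat.div_eq_of_lt hlt, Nat.div_eq_of_lt hi]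
  · simp [outcomeCode, Nat.div_eq_of_lt hlt]
  · refine mul_mem (mul_mem (xOp_single_mem_decoupled_search rfl _)
      (zOp_single_mem_decoupled_search rfl _)) (proj_mem_decoupled ?_ a)
    rw [PauliString.toMatrix_xOn]
    exact xOp_ind_mem_decoupled_search fun _ _ _ _ => Finset.mem_univ _
  · intro v
    rw [← mul_assoc, xOp_mul_error, one_mul, smul_mul_assoc, mul_assoc _ (xOp v), mul_assoc _ _ (xOp v),
      (xOp_commute_proj_xOn v _ a).eq]

/-- The value `τ = 2 ^ m - 1` covers the absence of errors: no pair has this number, so the flip is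
trivial, and its digits are all 1, matching checks that all agree. -/
theorem purifies_oneErrorProtocol_flip (hm : 2 ≤ m) {τ : ℕ} (hτ : τ < 2 ^ m) :
    (oneErrorProtocol m (finalStep hm)).Purifies (xOp (flipAt _ τ)) := by
  refine purifies_measure_xOn (c := 0) (by rw [(xOp_commute _ _).eq]; simp) fun a b hab => ?_
  have hab1 : a = b := by simpa using hab
  rw [if_neg (by simpa using hab1)]
  refine purifies_hammingChecks hm hab1 le_rfl (τ := τ) ?_ ?_ ?_
  · simp [outcomeCode, Nat.div_eq_of_lt hτ]
  · rw [← mul_assoc, xOp_mul_self, one_mul]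
    refine proj_mem_decoupled ?_ a
    rw [PauliString.toMatrix_xOn]
    exact xOp_univ_mem_decoupled_hamming hm
  · intro j hj
    have h1 : Commute (zOp (ind (hammingSet m j))) ((PauliString.xOn Finset.univ).proj a) :=
      ((Commute.one_right _).add_right ((zOp_hammingSet_commute hm hj).smul_right _)).smul_right _
    rw [← mul_assoc, zOp_mul_xOp, smul_mul_assoc, mul_assoc, h1.eq, mul_assoc]
    congr 1
    by_cases hτ2 : τ < 2 ^ m - 1
    · have h2 := flipAt_val (⟨τ, hτ2⟩ : Fin (2 ^ m - 1))
      simp only at h2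
      rw [h2, chi_single]
      simp [ind, hammingSet]
    · have h2 : τ = 2 ^ m - 1 := by omega
      subst h2
      rw [flipAt_self, chi_zero]
      simp [Nat.testBit_two_pow_sub_one, hj]

theorem corrects_oneErrorProtocol (hm : 2 ≤ m) :
    (oneErrorProtocol m (finalStep hm)).Corrects 1 (2 ^ m - m - 2) := by
  refine corrects_one (keepsAtLeast_oneErrorProtocol hm) (Nat.pos_of_neZero _) fun t e c => ?_
  obtain rfl | rfl : c = 0 ∨ c = 1 := Fin.two_cases c
  · rw [Pi.single_zero, zOp_zero, mul_one]
    obtain rfl | rfl : e = 0 ∨ e = 1 := Fin.two_cases e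
    · have h := purifies_oneErrorProtocol_flip hm (τ := 2 ^ m - 1)
        (Nat.sub_lt (by positivity) one_pos)
      rwa [flipAt_self, ← Pi.single_zero t] at h
    · rw [← flipAt_val]
      exact purifies_oneErrorProtocol_flip hm (by omega)
  · exact purifies_oneErrorProtocol_phase hm t e

end EPP

end Protocol

/-! ### Stabilizer codes -/

theorem xOp_mul_zOp_mul {n : ℕ} (v w v' w' : QBasis (Fin n)) :
    xOp v * zOp w * (xOp v' * zOp w') = chi w v' • (xOp (v + v') * zOp (w + w')) := by
  rw [mul_assoc, ← mul_assoc (zOp w), zOp_mul_xOp, smul_mul_assoc, mul_smul_comm, xOp_add, zOp_add]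
  simp only [mul_assoc]

theorem xOp_mul_zOp_apply {n : ℕ} (v w x y : QBasis (Fin n)) :
    (xOp v * zOp w) x y = if x = y + v then chi w y else 0 := by
  rw [zOp, Matrix.mul_diagonal, xOp_apply, ite_mul, one_mul, zero_mul]

theorem eq_zero_of_chi_eq_one {n : ℕ} {w : QBasis (Fin n)} (h : ∀ x, chi w x = 1) : w = 0 := by
  ext1 i
  have h1 := h (Pi.single i 1)
  rw [chi_single, mul_one, ← sgn_zero] at h1
  exact sgn_injective h1

theorem eq_zero_of_xOp_mul_zOp_eq_smul_one {n : ℕ} {v w : QBasis (Fin n)} {ε : ℂ}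
    (h : xOp v * zOp w = ε • 1) : v = 0 ∧ w = 0 ∧ ε = 1 := by
  have key : ∀ y, chi w y = if v = 0 then ε else 0 := fun y => by
    have h1 := congrFun (congrFun h (y + v)) y
    rw [xOp_mul_zOp_apply, if_pos rfl, Matrix.smul_apply, Matrix.one_apply] at h1
    simpa using h1
  have h0 := key 0
  rw [chi_zero] at h0
  by_cases hv : v = 0
  · rw [if_pos hv] at h0
    refine ⟨hv, eq_zero_of_chi_eq_one fun y => ?_, h0.symm⟩
    rw [key, if_pos hv, h0]
  · rw [if_neg hv] at h0
    exact absurd h0 one_ne_zero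

/-- The Pauli matrix with given exponents of `X` and `Z`. -/
def Pauli.ofParts (a b : Fin 2) : Pauli :=
  if a = 0 then (if b = 0 then .I else .Z) else if b = 0 then .X else .Y

theorem Pauli.xPart_ofParts (a b : Fin 2) : (Pauli.ofParts a b).xPart = a := by
  fin_cases a <;> fin_cases b <;> rfl

theorem Pauli.zPart_ofParts (a b : Fin 2) : (Pauli.ofParts a b).zPart = b := by
  fin_cases a <;> fin_cases b <;> rfl

theorem PauliString.xOp_mul_zOp_eq {n : ℕ} (P : PauliString n) :
    ∃ e : ℕ, xOp (fun i => (P i).xPart) * zOp (fun i => (P i).zPart) =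
      Complex.I ^ e • P.toMatrix := by
  -- The inverse of `I ^ s` is `I ^ (3 * s)`.
  refine ⟨3 * ∑ i, (P i).phase, ?_⟩
  rw [P.toMatrix_eq, smul_smul, ← pow_add, ← Nat.succ_mul, pow_mul, Complex.I_pow_four, one_pow,
    one_smul]

/-- A code is given by an additive group of exponents of `X` and `Z` all of whose phases vanish. -/
theorem existsStabilizerCode_of_hom {n k t : ℕ} {G : Type} [AddCommGroup G]
    (v w : G →+ QBasis (Fin n)) (hvw : ∀ g g', chi (w g) (v g') = 1)
    (hinj : ∀ g, v g = 0 → w g = 0 → g = 0) (hcard : Nat.card G * 2 ^ k = 2 ^ n)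
    (hdetect : ∀ E : PauliString n, E.weight < 2 * t + 1 →
      (∀ g, chi (fun i => (E i).zPart) (v g) = chi (w g) fun i => (E i).xPart) →
        ∃ g, v g = (fun i => (E i).xPart) ∧ w g = fun i => (E i).zPart) :
    ExistsStabilizerCode n k t := by
  let f : Multiplicative G →* QOp (Fin n) :=
    { toFun := fun g => xOp (v g.toAdd) * zOp (w g.toAdd)
      map_one' := by simp
      map_mul' := fun g g' => by
        rw [xOp_mul_zOp_mul, hvw, one_smul, toAdd_mul, map_add, map_add] }
  have hf : ∀ g, (f.toHomUnits g : QOp (Fin n)) = xOp (v g.toAdd) * zOp (w g.toAdd) :=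
    fun g => rfl
  have hfinj : Function.Injective f.toHomUnits := by
    rw [injective_iff_map_eq_one]
    intro g hg
    have h1 := congrArg Units.val hg
    rw [hf, Units.val_one, ← one_smul ℂ (1 : QOp (Fin n))] at h1
    obtain ⟨hv, hw, _⟩ := eq_zero_of_xOp_mul_zOp_eq_smul_one h1
    exact hinj g.toAdd hv hw
  refine ⟨f.toHomUnits.range, ⟨?_, ?_, ?_⟩, ?_, ?_⟩
  · rintro _ ⟨g, rfl⟩
    let P : PauliString n := fun i => Pauli.ofParts (v g.toAdd i) (w g.toAdd i)
    obtain ⟨e, he⟩ := P.xOp_mul_zOp_eq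
    refine ⟨e, P, ?_⟩
    rw [hf, ← he]
    simp only [P, Pauli.xPart_ofParts, Pauli.zPart_ofParts]
  · rintro _ ⟨g, rfl⟩ _ ⟨g', rfl⟩
    rw [← map_mul, ← map_mul, mul_comm]
  · rintro ⟨g, hg⟩
    have h1 := congrArg Units.val hg
    rw [hf, Units.val_neg, Units.val_one, ← neg_one_smul ℂ (1 : QOp (Fin n))] at h1
    have h2 := (eq_zero_of_xOp_mul_zOp_eq_smul_one h1).2.2
    norm_num at h2
  · rw [← hcard, ← Nat.card_congr (MonoidHom.ofInjective hfinj).toEquiv]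
    rfl
  · intro E hE hcomm
    obtain ⟨g, hg1, hg2⟩ := hdetect E hE fun g => by
      have h1 := (hcomm _ ⟨Multiplicative.ofAdd g, rfl⟩).smul_left
        (Complex.I ^ (3 * ∑ i, (E i).phase))
      rw [E.toMatrix_eq, smul_smul, ← pow_add, ← Nat.succ_mul, pow_mul, Complex.I_pow_four,
        one_pow, one_smul, hf, Commute, SemiconjBy, xOp_mul_zOp_mul, xOp_mul_zOp_mul] at h1
      -- In column 0 this is the only nonzero entry; there the two products differ just by their
      -- commutation signs.
      have h2 := congrFun (congrFun h1 ((fun i => (E i).xPart) + v g)) 0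
      simpa [xOp_mul_zOp_apply, add_comm] using h2
    obtain ⟨e, he⟩ := E.xOp_mul_zOp_eq
    refine ⟨_, ⟨Multiplicative.ofAdd g, rfl⟩, e, ?_⟩
    rw [hf, ← he, toAdd_ofAdd, hg1, hg2]

/-- The group of all Z-products is its own commutant among Pauli operators up to phase, so no error
weight matters. -/
theorem existsStabilizerCode_zero (n t : ℕ) : ExistsStabilizerCode n 0 t := by
  refine existsStabilizerCode_of_hom (0 : QBasis (Fin n) →+ QBasis (Fin n)) (AddMonoidHom.id _)
    (by simp) (fun g _ h => h) (by simp) fun E _ h => ⟨fun i => (E i).zPart, ?_, rfl⟩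
  refine (eq_zero_of_chi_eq_one fun x => ?_).symm
  rw [chi_comm]
  simpa using (h x).symm

/-- The identification of the field with two elements with the labels of a qubit. -/
def bit : ZMod 2 →+ Fin 2 where
  toFun a := a
  map_zero' := rfl
  map_add' _ _ := rfl

theorem bit_injective : Function.Injective bit := fun _ _ h => h

theorem bit_one : bit 1 = 1 := rfl

/-! ### A code whose positions are the elements of a finite field -/

section FieldCode

variable {n : ℕ} {F : Type} [Field F] [Algebra (ZMod 2) F]

/-- The affine function `a + f` on the field, restricted to the positions. -/
def affineLabel (e : Fin n ≃ F) : ZMod 2 × Module.Dual (ZMod 2) F →+ QBasis (Fin n) where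
  toFun p i := bit (p.1 + p.2 (e i))
  map_zero' := by ext1 i; simp
  map_add' p q := by
    ext1 i
    simp only [Prod.fst_add, Prod.snd_add, LinearMap.add_apply, Pi.add_apply, ← map_add]
    rw [add_add_add_comm]

/-- The exponents of `X`: the affine function with constant `g.1` and linear part `g.2.2`. -/
def codeX (e : Fin n ≃ F) : ZMod 2 × ZMod 2 × Module.Dual (ZMod 2) F →+ QBasis (Fin n) where
  toFun g := affineLabel e (g.1, g.2.2)
  map_zero' := map_zero _
  map_add' _ _ := map_add (affineLabel e) (_, _) (_, _)

/-- The exponents of `Z`: the affine function with constant `g.2.1` and linear part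
`x ↦ g.2.2 (ω * x)`. -/
def codeZ (e : Fin n ≃ F) (ω : F) :
    ZMod 2 × ZMod 2 × Module.Dual (ZMod 2) F →+ QBasis (Fin n) where
  toFun g := affineLabel e (g.2.1, g.2.2.comp (LinearMap.mulLeft (ZMod 2) ω))
  map_zero' := by
    simp only [Prod.fst_zero, Prod.snd_zero, LinearMap.zero_comp]; exact map_zero _
  map_add' g g' := by
    simp only [Prod.fst_add, Prod.snd_add, LinearMap.add_comp]
    rw [← map_add, Prod.mk_add_mk]

/-- In dimension above 2 the two linear parts share a nonzero kernel vector. Translation by it pairs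
positions with equal values, so the signs cancel. -/
theorem chi_affineLabel (e : Fin n ≃ F) (hF : 2 < Module.finrank (ZMod 2) F)
    (p q : ZMod 2 × Module.Dual (ZMod 2) F) : chi (affineLabel e p) (affineLabel e q) = 1 := by
  have : FiniteDimensional (ZMod 2) F := Module.finite_of_finrank_pos (by omega)
  obtain ⟨x, hx, hx0⟩ := (Submodule.ne_bot_iff _).1
    (LinearMap.ker_ne_bot_of_finrank_lt (f := p.2.prod q.2) (by simpa using hF))
  replace hx : p.2 x = 0 ∧ q.2 x = 0 := Prod.mk_eq_zero.1 hx
  have h2 : x + x = 0 := by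
    rw [← two_smul (ZMod 2) x, show (2 : ZMod 2) = 0 from rfl, zero_smul]
  refine Finset.prod_involution (fun i _ => e.symm (e i + x)) ?_ ?_ (by simp) ?_
  · intro i _
    simp [affineLabel, hx.1, hx.2, sgn_mul_self]
  · intro i _ _ h
    rw [Equiv.symm_apply_eq] at h
    exact hx0 (by simpa using h)
  · intro i _
    simp [add_assoc, h2]

/-- The code is nondegenerate: the only error on at most two positions that commutes with the
stabilizer is the identity, hence the witness 0. -/
theorem existsStabilizerCode_field {k : ℕ} (e : Fin n ≃ F) (hn : 2 < n)
    (hF : 2 < Module.finrank (ZMod 2) F)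
    (hcard : Nat.card (ZMod 2 × ZMod 2 × Module.Dual (ZMod 2) F) * 2 ^ k = 2 ^ n) :
    ExistsStabilizerCode n k 1 := by
  classical
  obtain ⟨ω, hω0, hω1⟩ : ∃ ω : F, ω ≠ 0 ∧ ω ≠ 1 := by
    have : Fintype F := Fintype.ofEquiv _ e
    obtain ⟨ω, _, hω⟩ := Finset.exists_mem_notMem_of_card_lt_card
      (s := ({0, 1} : Finset F)) (t := Finset.univ) (by
        rw [Finset.card_univ, ← Fintype.card_congr e, Fintype.card_fin]
        exact Finset.card_le_two.trans_lt hn)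
    simp only [Finset.mem_insert, Finset.mem_singleton, not_or] at hω
    exact ⟨ω, hω⟩
  refine existsStabilizerCode_of_hom (codeX e) (codeZ e ω) (fun g g' => chi_affineLabel e hF _ _)
    ?_ hcard fun E hE h => ⟨0, ?_⟩
  · rintro ⟨a, b, f⟩ h1 h2
    have h3 : ∀ x, a + f x = 0 := fun x => bit_injective (by
      simpa [codeX, affineLabel] using congrFun h1 (e.symm x))
    have h4 : ∀ x, b + f (ω * x) = 0 := fun x => bit_injective (by
      simpa [codeZ, affineLabel] using congrFun h2 (e.symm x))
    have ha : a = 0 := by simpa using h3 0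
    have hb : b = 0 := by simpa using h4 0
    subst ha hb
    simp only [zero_add] at h3
    simp only [Prod.mk_eq_zero, true_and]
    exact LinearMap.ext h3
  · obtain ⟨T, hT, -, hTcard⟩ := Finset.exists_subsuperset_card_eq
      (s := Finset.univ.filter fun i => E i ≠ Pauli.I) (t := Finset.univ) (n := 2)
      (Finset.subset_univ _) (by rw [PauliString.weight] at hE; omega)
      (by rw [Finset.card_univ, Fintype.card_fin]; omega)
    obtain ⟨p, q, hpq, rfl⟩ := Finset.card_eq_two.1 hTcard
    have hI : ∀ i, i ∉ ({p, q} : Finset (Fin n)) → E i = Pauli.I := fun i hi => by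
      by_contra h1
      exact hi (hT (by simpa using h1))
    have hchi : ∀ (z x : QBasis (Fin n)), (∀ i, E i = Pauli.I → z i = 0) →
        chi z x = sgn (z p * x p) * sgn (z q * x q) := by
      intro z x hz
      rw [← Finset.prod_pair (f := fun i => sgn (z i * x i)) hpq, chi,
        Finset.prod_subset (Finset.subset_univ {p, q})]
      intro i _ hi
      rw [hz i (hI i hi), zero_mul, sgn_zero]
    have hX : ∀ i, E i = Pauli.I → (E i).xPart = 0 := fun i hi => by rw [hi]; rfl
    have hZ : ∀ i, E i = Pauli.I → (E i).zPart = 0 := fun i hi => by rw [hi]; rfl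
    have hmain : ∀ g, sgn ((E p).zPart * codeX e g p) * sgn ((E q).zPart * codeX e g q) =
        sgn ((E p).xPart * codeZ e ω g p) * sgn ((E q).xPart * codeZ e ω g q) := fun g => by
      rw [← hchi (fun i => (E i).zPart) _ hZ, ← hchi (fun i => (E i).xPart) _ hX, h g, chi_comm]
    have hd : e p + e q ≠ 0 := fun h1 => by
      have h2 : e q + e q = 0 := by
        rw [← two_smul (ZMod 2), show (2 : ZMod 2) = 0 from rfl, zero_smul]
      exact hpq (e.injective (add_right_cancel (h1.trans h2.symm)))
    have hz : (E q).zPart = (E p).zPart := by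
      -- This element is the product of all X; it compares the Z-parts at `p` and `q`. Below, `(0,
      -- 1, 0)` is the product of all Z and compares the X-parts.
      have h1 := hmain (1, 0, 0)
      simp only [codeX, codeZ, affineLabel, AddMonoidHom.coe_mk, ZeroHom.coe_mk,
        LinearMap.zero_apply, LinearMap.zero_comp, add_zero, map_zero, bit_one, mul_one, mul_zero,
        sgn_zero] at h1
      revert h1
      generalize (E q).zPart = a
      generalize (E p).zPart = b
      fin_cases a <;> fin_cases b <;> norm_num
    have hx : (E q).xPart = (E p).xPart := by
      have h1 := hmain (0, 1, 0)
      simp only [codeX, codeZ, affineLabel, AddMonoidHom.coe_mk, ZeroHom.coe_mk,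
        LinearMap.zero_apply, LinearMap.zero_comp, add_zero, map_zero, bit_one, mul_one, mul_zero,
        sgn_zero] at h1
      revert h1
      generalize (E q).xPart = a
      generalize (E p).xPart = b
      fin_cases a <;> fin_cases b <;> norm_num
    have hf : ∀ f : Module.Dual (ZMod 2) F, (E p).zPart * bit (f (e p + e q)) =
        (E p).xPart * bit (f (ω * (e p + e q))) := fun f => by
      have h1 := hmain (0, 0, f)
      simp only [codeX, codeZ, affineLabel, AddMonoidHom.coe_mk, ZeroHom.coe_mk, zero_add,
        LinearMap.comp_apply, LinearMap.mulLeft_apply, hz, hx, ← sgn_add,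
        ← map_add, ← mul_add] at h1
      exact sgn_injective h1
    have hdual : ∀ x : F, x ≠ 0 → ∃ f : Module.Dual (ZMod 2) F, f x ≠ 0 := fun x hx => by
      by_contra! h1
      exact hx ((Module.forall_dual_apply_eq_zero_iff (ZMod 2) x).1 h1)
    have hbit : ∀ a, bit a = 0 → a = 0 := fun a h => h
    have hzero : (E p).xPart = 0 ∧ (E p).zPart = 0 := by
      revert hf
      generalize (E p).xPart = a
      generalize (E p).zPart = b
      intro hf
      obtain rfl | rfl : a = 0 ∨ a = 1 := Fin.two_cases a
      all_goals obtain rfl | rfl : b = 0 ∨ b = 1 := Fin.two_cases b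
      · exact ⟨rfl, rfl⟩
      · obtain ⟨f, hf1⟩ := hdual _ hd
        exact absurd (hbit _ (by simpa using hf f)) hf1
      · obtain ⟨f, hf1⟩ := hdual _ (mul_ne_zero hω0 hd)
        exact absurd (hbit _ (by simpa using (hf f).symm)) hf1
      -- A Y at both positions would give `f d = f (ω d)` for all `f`, where `d = e p + e q`; a
      -- functional nonzero at `(ω - 1) d` refutes this.
      · obtain ⟨f, hf1⟩ := hdual _ (mul_ne_zero (sub_ne_zero.2 hω1) hd)
        refine absurd ?_ hf1
        have h1 : f (e p + e q) = f (ω * (e p + e q)) :=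
          bit_injective (by simpa using hf f)
        rw [sub_mul, one_mul, map_sub, h1, sub_self]
    rw [map_zero, map_zero]
    constructor <;> ext1 i
    · by_cases hi : i ∈ ({p, q} : Finset (Fin n))
      · rcases Finset.mem_insert.1 hi with rfl | hi
        · exact hzero.1.symm
        · rw [Finset.mem_singleton.1 hi, hx]; exact hzero.1.symm
      · exact (hX i (hI i hi)).symm
    · by_cases hi : i ∈ ({p, q} : Finset (Fin n))
      · rcases Finset.mem_insert.1 hi with rfl | hi
        · exact hzero.2.symm
        · rw [Finset.mem_singleton.1 hi, hz]; exact hzero.2.symm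
      · exact (hZ i (hI i hi)).symm

end FieldCode

theorem add_two_le_two_pow {m : ℕ} (hm : 2 ≤ m) : m + 2 ≤ 2 ^ m := by
  induction m, hm using Nat.le_induction with
  | base => norm_num
  | succ m _ ih => rw [pow_succ]; omega

/-- The field code has `m + 2` generators but needs `m ≥ 3` for commutation. For `m = 2` no qubit is
encoded, so the group of Z-products suffices. -/
theorem existsStabilizerCode_two_pow {m : ℕ} (hm : 2 ≤ m) :
    ExistsStabilizerCode (2 ^ m) (2 ^ m - m - 2) 1 := by
  rcases hm.eq_or_lt with rfl | hm3
  · exact existsStabilizerCode_zero _ _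
  · have : Fact (Nat.Prime 2) := ⟨Nat.prime_two⟩
    have hF := GaloisField.finrank 2 (n := m) (by omega)
    have hcard := GaloisField.card 2 m (by omega)
    have hfin : Finite (GaloisField 2 m) := Nat.finite_of_card_ne_zero (by rw [hcard]; positivity)
    have hdual : Nat.card (Module.Dual (ZMod 2) (GaloisField 2 m)) = 2 ^ m := by
      rw [Module.natCard_eq_pow_finrank (K := ZMod 2), Subspace.dual_finrank_eq, hF, Nat.card_zmod]
    have h2 := add_two_le_two_pow hm
    have h3 : 2 ^ 2 < 2 ^ m := Nat.pow_lt_pow_right (by norm_num) hm3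
    refine existsStabilizerCode_field (F := GaloisField 2 m)
      ((finCongr hcard.symm).trans (Finite.equivFin _).symm) (by omega) (by omega) ?_
    rw [Nat.card_prod, Nat.card_prod, hdual, Nat.card_zmod, ← mul_assoc, mul_assoc, ← pow_add]
    rw [show 2 * 2 = 2 ^ 2 from rfl, ← pow_add]
    congr 1
    omega

/-- After division by `2 ^ k` the bound would read `1 + 3 (2 ^ m - 1) ≤ 2 ^ (m + 1)`, which fails
once `2 ^ m > 2`. -/
theorem not_quantumHammingBound {m : ℕ} (hm : 2 ≤ m) :
    ¬ QuantumHammingBound (2 ^ m - 1) (2 ^ m - m - 2) 1 := by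
  have h2 := add_two_le_two_pow hm
  have h3 : 2 ^ m - 1 = (2 ^ m - m - 2) + (m + 1) := by omega
  rw [QuantumHammingBound, Finset.sum_range_succ, Finset.sum_range_one, Nat.choose_one_right,
    pow_zero, Nat.choose_zero_right, pow_one, one_mul, not_le]
  nth_rewrite 1 [h3]
  rw [pow_add]
  refine Nat.mul_lt_mul_of_pos_left ?_ (by positivity)
  rw [pow_succ]
  omega

theorem mainTheorem3 (m : ℕ) (hm : 2 ≤ m) :
    (∃ final : List (Bool × Bool) → FinalStep (2 ^ m - 1),
      (EPP.oneErrorProtocol m final).IsStabilizerEPP ∧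
        (EPP.oneErrorProtocol m final).Corrects 1 (2 ^ m - m - 2)) ∧
      ExistsStabilizerCode (2 ^ m) (2 ^ m - m - 2) 1 ∧
      ¬ QuantumHammingBound (2 ^ m - 1) (2 ^ m - m - 2) 1 := by
  have h := add_two_le_two_pow hm
  have : NeZero (2 ^ m - 1) := ⟨by omega⟩
  exact ⟨⟨finalStep hm, EPP.isStabilizerEPP_oneErrorProtocol hm _,
    EPP.corrects_oneErrorProtocol hm⟩, existsStabilizerCode_two_pow hm, not_quantumHammingBound hm⟩

end
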